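/- Let $\mathcal A$ be a complex algebra acting by bounded operators on a Hilbert space $\mathfrak H$, let $\sigma$ be an automorphism of $\mathcal A$, and let $(\mathcal A,\mathfrak H,D)$ be a $\sigma$-spectral triple: $D$ is a (possibly unbounded) self-adjoint operator with compact resolvent such that $D\,a-\sigma(a)\,D$ is bounded for all $a\in\mathcal A$. Let $n\ge 1$ be an integer, and assume that $D$ is invertible with $D^{-1}\in\mathcal L^{n,\infty}$, that is, with $\mu_0(T)\ge\mu_1(T)\ge\cdots$ the characteristic values of $T$, $\sum_{k<N}\mu_k(D^{-1})=O\big(\sum_{k=1}^{N}k^{-1/n}\big)$ as $N\to\infty$. Let $\mathrm{Tr}_\omega$ be a Dixmier trace on $\mathcal L^{1,\infty}=\{T:\sum_{k<N}\mu_k(T)=O(\log N)\}$, i.e. the linear functional given on positive $T$ by $\mathrm{Lim}_\omega\,\frac1{\log N}\sum_{k<N}\mu_k(T)$, where $\mathrm{Lim}_\omega$ is a positive linear form on bounded sequences that extends the limit and is invariant under $(\alpha_1,\alpha_2,\dots)\mapsto(\alpha_1,\alpha_1,\alpha_2,\alpha_2,\dots)$. Then $T D^{-n}\in\mathcal L^{1,\infty}$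 for every bounded operator $T$, and: (1) The functional $\varphi(a)=\mathrm{Tr}_\omega(a\,D^{-n})$, $a\in\mathcal A$, is linear and is a $\sigma^{-n}$-trace on $\mathcal A$: $\varphi(a\,b)=\varphi(b\,\sigma^{-n}(a))$ for all $a,b\in\mathcal A$. (2) More generally, for every bounded operator $T$ on $\mathfrak H$ and every $a\in\mathcal A$, $$\mathrm{Tr}_\omega(T\,\sigma^{-n}(a)\,D^{-n})=\mathrm{Tr}_\omega(a\,T\,D^{-n}).$$ (3) If the $\sigma$-spectral triple is Lipschitz-regular, i.e. $|D|\,a-\sigma(a)\,|D|$ is also bounded for all $a\in\mathcal A$, then the same statements hold with $D^{-n}$ replaced by $|D|^{-n}$. -/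

import Mathlib

open Filter Topology BoundedContinuousFunction ComplexStarModule

noncomputable section

namespace TwistedTriple

section Ideals

variable {H : Type*} [NormedAddCommGroup H] [InnerProductSpace ℂ H] [CompleteSpace H]

/-- The `k`-th characteristic value (singular value, `k = 0, 1, …`) of a bounded operator: the
distance from `T` to the operators of rank at most `k`. For compact `T` these are the eigenvalues
of `|T|` in decreasing order, counted with multiplicity. -/
def charValue (T : H →L[ℂ] H) (k : ℕ) : ℝ :=
  sInf {r : ℝ | ∃ F : H →L[ℂ] H, LinearMap.rank (F : H →ₗ[ℂ] H) ≤ (k : Cardinal) ∧ r = ‖T - F‖}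

/-- The partial sum `σ_N(T) = ∑_{k < N} μ_k(T)`. -/
def partialSum (T : H →L[ℂ] H) (N : ℕ) : ℝ :=
  ∑ k ∈ Finset.range N, charValue T k

/-- The ideal `𝓛^{p,∞}`, `1 ≤ p < ∞`: the partial sums of the characteristic values are
dominated by those of the sequence `(k + 1)^{-1/p}`. For `p > 1` this says
`σ_N(T) = O(N^{1 - 1/p})`, equivalently `μ_k(T) = O(k^{-1/p})`; for `p = 1` it says
`σ_N(T) = O(log N)`, so that `𝓛^{1,∞}` is the domain of the Dixmier traces. -/
def MemIdeal (p : ℝ) (T : H →L[ℂ] H) : Prop :=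
  ∃ C : ℝ, ∀ N : ℕ,
    partialSum T N ≤ C * ∑ k ∈ Finset.range N, ((k : ℝ) + 1) ^ (-(1 / p))

/-- The functionals `Lim_ω` on bounded sequences that enter the Dixmier traces: linear, positive,
extending the limit, and invariant under `(α₀, α₁, …) ↦ (α₀, α₀, α₁, α₁, …)`. -/
structure DixmierLimit where
  /-- the underlying linear functional on bounded real sequences -/
  lim : (ℕ →ᵇ ℝ) →ₗ[ℝ] ℝ
  nonneg : ∀ α : ℕ →ᵇ ℝ, (∀ i, 0 ≤ α i) → 0 ≤ lim α
  eq_of_tendsto : ∀ (α : ℕ →ᵇ ℝ) (l : ℝ), Tendsto (fun i => α i) atTop (𝓝 l) → lim α = l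
  dilation : ∀ α β : ℕ →ᵇ ℝ, (∀ i, β i = α (i / 2)) → lim β = lim α

/-- The sequence `σ_N(T) / log N`, listed from `N = 2` on. -/
def logMean (T : H →L[ℂ] H) (i : ℕ) : ℝ :=
  partialSum T (i + 2) / Real.log ((i : ℝ) + 2)

open Classical in
/-- `Lim_ω σ_N(T) / log N`, for positive `T` in `𝓛^{1,∞}` (with value `0` where the sequence is
unbounded, that is, outside the ideal). -/
def dixmierPos (ω : DixmierLimit) (T : H →L[ℂ] H) : ℝ :=
  if h : ∃ C : ℝ, ∀ i, ‖logMean T i‖ ≤ C then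
    ω.lim (BoundedContinuousFunction.ofNormedAddCommGroupDiscrete (logMean T) h.choose
      h.choose_spec)
  else 0

/-- The Dixmier trace `Tr_ω` on `𝓛^{1,∞}`: the linear extension of `dixmierPos` from the positive
cone, through the positive and negative parts of the real and imaginary parts of `T`. -/
def dixmierTrace (ω : DixmierLimit) (T : H →L[ℂ] H) : ℂ :=
  ((dixmierPos ω (ℜ T : H →L[ℂ] H)⁺ - dixmierPos ω (ℜ T : H →L[ℂ] H)⁻ : ℝ) : ℂ) +
    Complex.I *
      ((dixmierPos ω (ℑ T : H →L[ℂ] H)⁺ - dixmierPos ω (ℑ T : H →L[ℂ] H)⁻ : ℝ) : ℂ)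

end Ideals

section Unbounded

variable {H : Type*} [NormedAddCommGroup H] [InnerProductSpace ℂ H]

/-- `R = D⁻¹` as an everywhere defined bounded operator: the graph of `R` is the transposed graph
of `D`. -/
def IsInverse (D : H →ₗ.[ℂ] H) (R : H →L[ℂ] H) : Prop :=
  ∀ x y : H, (x, y) ∈ D.graph ↔ R y = x

/-- `R = (D - z)⁻¹` as an everywhere defined bounded operator. -/
def IsResolvent (D : H →ₗ.[ℂ] H) (z : ℂ) (R : H →L[ℂ] H) : Prop :=
  ∀ x y : H, (x, y) ∈ D.graph ↔ R (y - z • x) = x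

/-- Some (equivalently, every) resolvent of `D` is a compact operator. -/
def HasCompactResolvent (D : H →ₗ.[ℂ] H) : Prop :=
  ∃ (z : ℂ) (R : H →L[ℂ] H), IsResolvent D z R ∧ IsCompactOperator R

/-- `D b - c D` is bounded: `b` maps the domain of `D` into itself and `D b - c D`, defined on the
domain of `D`, is the restriction of a bounded operator. -/
def BoundedTwistedCommutator (D : H →ₗ.[ℂ] H) (b c : H →L[ℂ] H) : Prop :=
  ∃ B : H →L[ℂ] H, ∀ x y : H, (x, y) ∈ D.graph → (b x, c y + B x) ∈ D.graph

/-- `(x, y)` belongs to the graph of `D ∘ D` (on its natural domain). -/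
def SqGraph (D : H →ₗ.[ℂ] H) (x y : H) : Prop :=
  ∃ z : H, (x, z) ∈ D.graph ∧ (z, y) ∈ D.graph

variable [CompleteSpace H]

/-- `E = |D|` for a self-adjoint `D`: the positive self-adjoint square root of `D²`. -/
structure IsAbs (D E : H →ₗ.[ℂ] H) : Prop where
  selfAdjoint : IsSelfAdjoint E
  nonneg : ∀ x y : H, (x, y) ∈ E.graph → 0 ≤ (inner ℂ x y).re
  sq : ∀ x y : H, SqGraph E x y ↔ SqGraph D x y

open Classical in
/-- The absolute value `|D|` of a self-adjoint operator. -/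
def opAbs (D : H →ₗ.[ℂ] H) : H →ₗ.[ℂ] H :=
  if h : ∃ E, IsAbs D E then h.choose else D

end Unbounded

section AbsFacts

variable {H : Type*} [NormedAddCommGroup H] [InnerProductSpace ℂ H] [CompleteSpace H]

theorem symm_graph {D : H →ₗ.[ℂ] H} (hD : IsSelfAdjoint D) {x y x' y' : H}
    (h : (x, y) ∈ D.graph) (h' : (x', y') ∈ D.graph) : inner ℂ y x' = inner ℂ x y' := by
  have hg := LinearPMap.adjoint_graph_eq_graph_adjoint hD.dense_domain
  rw [LinearPMap.isSelfAdjoint_def.mp hD] at hg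
  rw [hg, Submodule.mem_adjoint_iff] at h'
  exact sub_eq_zero.mp (h' x y h)

theorem IsInverse.isSelfAdjoint {D : H →ₗ.[ℂ] H} (hD : IsSelfAdjoint D) {R : H →L[ℂ] H}
    (hR : IsInverse D R) : IsSelfAdjoint R := by
  rw [ContinuousLinearMap.isSelfAdjoint_iff_isSymmetric]
  intro u v
  exact (symm_graph hD ((hR _ _).2 rfl) ((hR _ _).2 rfl)).symm

/-- An injective bounded self-adjoint operator is the inverse of a self-adjoint operator. -/
theorem exists_selfAdjoint_inverse {A : H →L[ℂ] H} (hA : IsSelfAdjoint A)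
    (hinj : ∀ x, A x = 0 → x = 0) : ∃ E : H →ₗ.[ℂ] H, IsSelfAdjoint E ∧ IsInverse E A := by
  have hsymm : ∀ u v, inner ℂ (A u) v = inner ℂ u (A v) :=
    ContinuousLinearMap.isSelfAdjoint_iff_isSymmetric.1 hA
  let P : H →ₗ.[ℂ] H := (A : H →ₗ[ℂ] H).toPMap ⊤
  have hker : P.toFun.ker = ⊥ := by
    rw [LinearMap.ker_eq_bot']
    rintro ⟨m, hm⟩ h
    exact Subtype.ext (hinj m h)
  have hinv : IsInverse P.inverse A := by
    intro x y
    rw [LinearPMap.inverse_graph hker]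
    constructor
    · rintro ⟨⟨a, b⟩, hab, he⟩
      rw [SetLike.mem_coe, LinearPMap.mem_graph_iff] at hab
      obtain ⟨c, rfl, rfl⟩ := hab
      simp only [LinearEquiv.coe_coe, LinearEquiv.prodComm_apply, Prod.swap_prod_mk,
        Prod.mk.injEq] at he
      rw [← he.1, ← he.2]
      rfl
    · rintro rfl
      refine ⟨(y, A y), ?_, rfl⟩
      rw [SetLike.mem_coe, LinearPMap.mem_graph_iff]
      exact ⟨⟨y, trivial⟩, rfl, rfl⟩
  have hdense : Dense (P.inverse.domain : Set H) := by
    rw [Submodule.dense_iff_topologicalClosure_eq_top,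
      Submodule.topologicalClosure_eq_top_iff, Submodule.eq_bot_iff]
    intro u hu
    apply hinj
    have h1 : inner ℂ (A (A u)) u = 0 := by
      apply (Submodule.mem_orthogonal _ _).1 hu
      exact LinearPMap.mem_domain_of_mem_graph ((hinv _ _).2 rfl)
    rw [hsymm] at h1
    exact inner_self_eq_zero.1 h1
  refine ⟨P.inverse, ?_, hinv⟩
  rw [LinearPMap.isSelfAdjoint_def]
  apply LinearPMap.eq_of_eq_graph
  rw [LinearPMap.adjoint_graph_eq_graph_adjoint hdense]
  ext ⟨u, v⟩
  rw [Submodule.mem_adjoint_iff, hinv]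
  constructor
  · intro h
    apply ext_inner_left ℂ
    intro w
    have := sub_eq_zero.1 (h (A w) w ((hinv _ _).2 rfl))
    rw [this, hsymm]
  · rintro rfl a b hab
    rw [hinv] at hab
    rw [← hab, hsymm, sub_self]

theorem isAbs_iff {D E : H →ₗ.[ℂ] H} (hD : IsSelfAdjoint D) {R : H →L[ℂ] H}
    (hR : IsInverse D R) : IsAbs D E ↔ IsSelfAdjoint E ∧ IsInverse E (CFC.abs R) := by
  have hRs := hR.isSelfAdjoint hD
  have hsq : CFC.abs R * CFC.abs R = R * R := by
    rw [CFC.abs_mul_abs, hRs.star_eq]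
  have hsq' : ∀ x, CFC.abs R (CFC.abs R x) = R (R x) := fun x => DFunLike.congr_fun hsq x
  have hDsq : ∀ x y, SqGraph D x y ↔ R (R y) = x := by
    intro x y
    constructor
    · rintro ⟨z, h1, h2⟩
      rw [(hR _ _).1 h2, (hR _ _).1 h1]
    · intro h
      exact ⟨R y, (hR _ _).2 h, (hR _ _).2 rfl⟩
  have hpos := (CFC.abs_nonneg R)
  rw [ContinuousLinearMap.nonneg_iff_isPositive] at hpos
  constructor
  · intro hE
    refine ⟨hE.selfAdjoint, ?_⟩
    have h0 : ∀ x, (x, (0 : H)) ∈ E.graph → x = 0 := by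
      intro x hx
      have : SqGraph E x 0 := ⟨0, hx, E.graph.zero_mem⟩
      rw [hE.sq, hDsq] at this
      simpa using this.symm
    have huniq : ∀ {x x' y : H}, (x, y) ∈ E.graph → (x', y) ∈ E.graph → x = x' := by
      intro x x' y h h'
      have := E.graph.sub_mem h h'
      rw [Prod.mk_sub_mk, sub_self] at this
      exact sub_eq_zero.1 (h0 _ this)
    have hsurj : ∀ y, ∃ x, (x, y) ∈ E.graph := by
      intro y
      obtain ⟨z, -, hz⟩ := (hE.sq (R (R y)) y).2 ((hDsq _ _).2 rfl)
      exact ⟨z, hz⟩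
    choose s hs using hsurj
    let S : H →ₗ[ℂ] H :=
      { toFun := s
        map_add' := fun a b => huniq (hs _) (E.graph.add_mem (hs a) (hs b))
        map_smul' := fun c a => huniq (hs _) (E.graph.smul_mem c (hs a)) }
    have hSsymm : S.IsSymmetric := fun u v =>
      (symm_graph hE.selfAdjoint (hs u) (hs v)).symm
    let S' : H →L[ℂ] H := ⟨S, hSsymm.continuous⟩
    have hinv : IsInverse E S' := by
      intro x y
      constructor
      · intro h
        exact huniq (hs y) h
      · rintro rfl
        exact hs y
    have hSpos : 0 ≤ S' := by
      rw [ContinuousLinearMap.nonneg_iff_isPositive]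
      refine ⟨hSsymm, fun x => ?_⟩
      have := hE.nonneg _ _ (hs x)
      exact this
    have hSS : S' * S' = star R * R := by
      rw [hRs.star_eq]
      ext y
      have : SqGraph E (S' (S' y)) y := ⟨S' y, hs _, hs _⟩
      rw [hE.sq, hDsq] at this
      exact this.symm
    have : CFC.abs R = S' := CFC.sqrt_unique hSS hSpos
    rw [this]
    exact hinv
  · rintro ⟨hs, hE⟩
    refine ⟨hs, ?_, ?_⟩
    · intro x y hxy
      rw [hE] at hxy
      rw [← hxy]
      exact hpos.2 y
    · intro x y
      rw [hDsq]
      constructor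
      · rintro ⟨z, h1, h2⟩
        rw [← hsq', (hE _ _).1 h2, (hE _ _).1 h1]
      · intro h
        exact ⟨CFC.abs R y, (hE _ _).2 (by rw [hsq', h]), (hE _ _).2 rfl⟩

theorem existsUnique_isAbs {D : H →ₗ.[ℂ] H} (hD : IsSelfAdjoint D) {R : H →L[ℂ] H}
    (hR : IsInverse D R) : ∃! E, IsAbs D E := by
  have hRs := hR.isSelfAdjoint hD
  have hinj : ∀ x, CFC.abs R x = 0 → x = 0 := by
    intro x hx
    have h1 : (CFC.abs R * CFC.abs R) x = 0 := by
      rw [mul_apply_eq_comp, hx, map_zero]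
    rw [CFC.abs_mul_abs, hRs.star_eq] at h1
    have h2 : ∀ y, R y = 0 → y = 0 := by
      intro y hy
      exact LinearPMap.graph_fst_eq_zero_snd D ((hR 0 y).2 hy) rfl
    exact h2 _ (h2 _ h1)
  obtain ⟨E, hE, hEi⟩ := exists_selfAdjoint_inverse
    (IsSelfAdjoint.of_nonneg (CFC.abs_nonneg R)) hinj
  refine ⟨E, (isAbs_iff hD hR).2 ⟨hE, hEi⟩, fun E' hE' => ?_⟩
  have hEi' := ((isAbs_iff hD hR).1 hE').2
  apply LinearPMap.eq_of_eq_graph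
  ext ⟨x, y⟩
  rw [hEi, hEi']

/-- `opAbs D` is the absolute value, for a self-adjoint `D` with bounded inverse. -/
theorem opAbs_spec {D : H →ₗ.[ℂ] H} (hD : IsSelfAdjoint D) {R : H →L[ℂ] H}
    (hR : IsInverse D R) : IsAbs D (opAbs D) := by
  have h : ∃ E, IsAbs D E := (existsUnique_isAbs hD hR).exists
  rw [opAbs, dif_pos h]
  exact h.choose_spec

end AbsFacts

section Triples

variable {A H : Type*} [NonUnitalRing A] [Module ℂ A]
  [NormedAddCommGroup H] [InnerProductSpace ℂ H] [CompleteSpace H]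

/-- The (not necessarily unital) algebra `A`, acting on `H` through `π`, together with `D`, is a
`σ`-spectral triple, `σ` being an algebra automorphism of `A`. -/
structure IsSpectralTriple (π : A →ₙₐ[ℂ] (H →L[ℂ] H)) (σ : A ≃ₗ[ℂ] A) (D : H →ₗ.[ℂ] H) :
    Prop where
  map_mul : ∀ a b : A, σ (a * b) = σ a * σ b
  selfAdjoint : IsSelfAdjoint D
  compactResolvent : HasCompactResolvent D
  bounded : ∀ a : A, BoundedTwistedCommutator D (π a) (π (σ a))

/-- Lipschitz regularity: `|D| a - σ(a) |D|` is bounded for every `a`. -/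
def IsLipschitzRegular (π : A →ₙₐ[ℂ] (H →L[ℂ] H)) (σ : A ≃ₗ[ℂ] A) (D : H →ₗ.[ℂ] H) : Prop :=
  ∀ a : A, BoundedTwistedCommutator (opAbs D) (π a) (π (σ a))

/-- `φ` is a `τ`-trace: `φ(a b) = φ(b τ(a))`. -/
def IsTwistedTrace (τ : A ≃ₗ[ℂ] A) (φ : A →ₗ[ℂ] ℂ) : Prop :=
  ∀ a b : A, φ (a * b) = φ (b * τ a)

end Triples

end TwistedTriple

end

/-! Write `R` for the inverse of `D`. Boundedness of `D a - σ(a) D` becomes `a R - R σ(a) = R B R`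
with `B` bounded. Starting from `b = σ⁻ⁿ(a)` and moving the `n` factors of `R` past it one at a time
gives `b Rⁿ - Rⁿ a = ∑ R^(j+1) B_j R^(n-j)` (`mul_pow_sub_pow_mul_eq_sum`). Each error term carries
`n + 1` factors of `R`. Since `R ∈ 𝓛^{n,∞}`, submultiplicativity of characteristic values makes it
trace class, so `Tr_ω` does not see it, even after multiplication by `T`. Thus `Tr_ω(T b Rⁿ) =
Tr_ω(T Rⁿ a)`, which equals `Tr_ω(a T Rⁿ)` because `Tr_ω` is a trace.

Most of the work is to show that `Tr_ω` is linear, is a trace and kills trace class operators.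
Additivity on the positive cone rests on `σ_N(A + B) ≤ σ_N(A) + σ_N(B) ≤ σ_{2N}(A + B)`, both
consequences of Ky Fan's principle that `σ_N` is the supremum of traces of compressions to subspaces
of dimension at most `N`; dilation invariance of the limit absorbs the doubling. The trace property
is unitary invariance, since unitaries span the bounded operators.

The Lipschitz-regular case is the same argument for `|D|`, whose inverse is `|R|`. -/

noncomputable section

namespace TwistedTriple

/-! ### Characteristic values as approximation numbers -/

section CharacteristicValues

variable {H : Type*} [NormedAddCommGroup H] [InnerProductSpace ℂ H]

theorem charValue_le {T F : H →L[ℂ] H} {k : ℕ}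
    (hF : LinearMap.rank (F : H →ₗ[ℂ] H) ≤ (k : Cardinal)) : charValue T k ≤ ‖T - F‖ :=
  csInf_le ⟨0, by rintro r ⟨G, -, rfl⟩; exact norm_nonneg _⟩ ⟨F, hF, rfl⟩

theorem rank_zero_le (k : ℕ) :
    LinearMap.rank ((0 : H →L[ℂ] H) : H →ₗ[ℂ] H) ≤ (k : Cardinal) := by
  rw [ContinuousLinearMap.toLinearMap_zero, LinearMap.rank_zero]
  exact zero_le

theorem charValue_set_nonempty (T : H →L[ℂ] H) (k : ℕ) :
    {r : ℝ | ∃ F : H →L[ℂ] H, LinearMap.rank (F : H →ₗ[ℂ] H) ≤ (k : Cardinal) ∧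
      r = ‖T - F‖}.Nonempty :=
  ⟨_, 0, rank_zero_le k, rfl⟩

theorem charValue_nonneg (T : H →L[ℂ] H) (k : ℕ) : 0 ≤ charValue T k :=
  le_csInf (charValue_set_nonempty T k) (by rintro r ⟨G, -, rfl⟩; exact norm_nonneg _)

theorem exists_norm_sub_lt (T : H →L[ℂ] H) (k : ℕ) {ε : ℝ} (hε : 0 < ε) :
    ∃ F : H →L[ℂ] H, LinearMap.rank (F : H →ₗ[ℂ] H) ≤ (k : Cardinal) ∧
      ‖T - F‖ < charValue T k + ε := by
  obtain ⟨r, ⟨F, hF, rfl⟩, hr⟩ := exists_lt_of_csInf_lt (charValue_set_nonempty T k)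
    (lt_add_of_pos_right (charValue T k) hε)
  exact ⟨F, hF, hr⟩

theorem charValue_le_norm (T : H →L[ℂ] H) (k : ℕ) : charValue T k ≤ ‖T‖ := by
  simpa using charValue_le (T := T) (rank_zero_le k)

theorem charValue_antitone (T : H →L[ℂ] H) : Antitone (charValue T) := by
  intro j k hjk
  refine le_of_forall_pos_lt_add fun ε hε => ?_
  obtain ⟨F, hF, h⟩ := exists_norm_sub_lt T j hε
  exact (charValue_le (hF.trans (by exact_mod_cast hjk))).trans_lt h

theorem charValue_add_le (S T : H →L[ℂ] H) (j k : ℕ) :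
    charValue (S + T) (j + k) ≤ charValue S j + charValue T k := by
  refine le_of_forall_pos_lt_add fun ε hε => ?_
  obtain ⟨F, hF, h⟩ := exists_norm_sub_lt S j (half_pos hε)
  obtain ⟨G, hG, h'⟩ := exists_norm_sub_lt T k (half_pos hε)
  have hr : LinearMap.rank ((F + G : H →L[ℂ] H) : H →ₗ[ℂ] H) ≤ ((j + k : ℕ) : Cardinal) := by
    rw [ContinuousLinearMap.toLinearMap_add, Nat.cast_add]
    exact (LinearMap.rank_add_le _ _).trans (add_le_add hF hG)
  have h1 := charValue_le (T := S + T) hr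
  have h2 : ‖S + T - (F + G)‖ ≤ ‖S - F‖ + ‖T - G‖ := by
    rw [add_sub_add_comm]
    exact norm_add_le _ _
  linarith

/-- If `F` and `G` approximate `S` and `T`, then `F T + (S - F) G` has rank at most `j + k` and
leaves the remainder `(S - F)(T - G)`. -/
theorem charValue_mul_le (S T : H →L[ℂ] H) (j k : ℕ) :
    charValue (S * T) (j + k) ≤ charValue S j * charValue T k := by
  have key : ∀ ε > 0, charValue (S * T) (j + k) ≤
      (charValue S j + ε) * (charValue T k + ε) := by
    intro ε hε
    obtain ⟨F, hF, h⟩ := exists_norm_sub_lt S j hε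
    obtain ⟨G, hG, h'⟩ := exists_norm_sub_lt T k hε
    have hr : LinearMap.rank ((F * T + (S - F) * G : H →L[ℂ] H) : H →ₗ[ℂ] H) ≤
        ((j + k : ℕ) : Cardinal) := by
      rw [ContinuousLinearMap.toLinearMap_add, Nat.cast_add]
      refine (LinearMap.rank_add_le _ _).trans (add_le_add ?_ ?_)
      · exact (LinearMap.rank_comp_le_left (T : H →ₗ[ℂ] H) (F : H →ₗ[ℂ] H)).trans hF
      · exact (LinearMap.rank_comp_le_right (G : H →ₗ[ℂ] H)
          ((S - F : H →L[ℂ] H) : H →ₗ[ℂ] H)).trans hG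
    have h1 := charValue_le (T := S * T) hr
    have h2 : S * T - (F * T + (S - F) * G) = (S - F) * (T - G) := by noncomm_ring
    rw [h2] at h1
    exact h1.trans ((norm_mul_le _ _).trans
      (mul_le_mul h.le h'.le (norm_nonneg _) (add_nonneg (charValue_nonneg _ _) hε.le)))
  have hlim : Tendsto (fun ε : ℝ => (charValue S j + ε) * (charValue T k + ε)) (𝓝[>] 0)
      (𝓝 (charValue S j * charValue T k)) := by
    have : Continuous fun ε : ℝ => (charValue S j + ε) * (charValue T k + ε) := by fun_prop
    simpa using (this.tendsto 0).mono_left nhdsWithin_le_nhds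
  exact ge_of_tendsto hlim (eventually_nhdsWithin_of_forall key)

theorem charValue_mul_left_le (X T : H →L[ℂ] H) (k : ℕ) :
    charValue (X * T) k ≤ ‖X‖ * charValue T k := by
  have h := charValue_mul_le X T 0 k
  rw [zero_add] at h
  exact h.trans (mul_le_mul_of_nonneg_right (charValue_le_norm X 0) (charValue_nonneg T k))

theorem charValue_mul_right_le (T X : H →L[ℂ] H) (k : ℕ) :
    charValue (T * X) k ≤ charValue T k * ‖X‖ :=
  (charValue_mul_le T X k 0).trans
    (mul_le_mul_of_nonneg_left (charValue_le_norm X 0) (charValue_nonneg T k))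

theorem charValue_pow_le (T : H →L[ℂ] H) (k m : ℕ) :
    charValue (T ^ m) (m * k) ≤ charValue T k ^ m := by
  induction m with
  | zero =>
    rw [pow_zero, pow_zero]
    exact (charValue_le_norm _ _).trans ContinuousLinearMap.norm_id_le
  | succ m ih =>
    rw [pow_succ, pow_succ, Nat.succ_mul]
    exact (charValue_mul_le _ _ _ _).trans
      (mul_le_mul_of_nonneg_right ih (charValue_nonneg T k))

theorem charValue_smul_le (c : ℂ) (T : H →L[ℂ] H) (k : ℕ) :
    charValue (c • T) k ≤ ‖c‖ * charValue T k := by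
  have h := charValue_mul_left_le (c • (1 : H →L[ℂ] H)) T k
  rw [smul_mul_assoc, one_mul] at h
  refine h.trans (mul_le_mul_of_nonneg_right ?_ (charValue_nonneg T k))
  rw [norm_smul]
  exact mul_le_of_le_one_right (norm_nonneg c) ContinuousLinearMap.norm_id_le

theorem charValue_smul (c : ℂ) (T : H →L[ℂ] H) (k : ℕ) :
    charValue (c • T) k = ‖c‖ * charValue T k := by
  refine le_antisymm (charValue_smul_le c T k) ?_
  by_cases hc : c = 0
  · rw [hc, norm_zero, zero_mul]
    exact charValue_nonneg _ _
  · have h := charValue_smul_le c⁻¹ (c • T) k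
    rw [inv_smul_smul₀ hc, norm_inv, inv_mul_eq_div, le_div_iff₀' (norm_pos_iff.2 hc)] at h
    exact h

/-- `G` factors through `H / ker F ≃ range F`, so its range is a linear image of `range F`. -/
theorem rank_le_of_ker_le {F G : H →ₗ[ℂ] H} (h : F.ker ≤ G.ker) : G.rank ≤ F.rank := by
  let L : F.range →ₗ[ℂ] H := (F.ker.liftQ G h).comp F.quotKerEquivRange.symm.toLinearMap
  have hL : G.range ≤ L.range := by
    rintro _ ⟨x, rfl⟩
    refine ⟨⟨F x, x, rfl⟩, ?_⟩
    have : F.quotKerEquivRange.symm ⟨F x, x, rfl⟩ = F.ker.mkQ x := by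
      rw [LinearEquiv.symm_apply_eq]
      rfl
    simp [L, this]
  exact (Submodule.rank_mono hL).trans (rank_range_le L)

variable [CompleteSpace H]

/-- Let `P` project onto the kernel of an approximant `F` of `T`. Then `S - S P` kills `ker F`, so
it has rank at most that of `F`, while `T` agrees with `T - F` on the range of `P`. -/
theorem charValue_le_of_norm_apply_le {S T : H →L[ℂ] H} (h : ∀ x, ‖S x‖ ≤ ‖T x‖) (k : ℕ) :
    charValue S k ≤ charValue T k := by
  refine le_of_forall_pos_lt_add fun ε hε => ?_
  obtain ⟨F, hF, hlt⟩ := exists_norm_sub_lt T k hε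
  let K : Submodule ℂ H := (F : H →ₗ[ℂ] H).ker
  have : CompleteSpace K := F.completeSpace_ker
  let P : H →L[ℂ] H := K.starProjection
  have hr : LinearMap.rank ((S - S * P : H →L[ℂ] H) : H →ₗ[ℂ] H) ≤ (k : Cardinal) := by
    refine (rank_le_of_ker_le (F := (F : H →ₗ[ℂ] H)) fun x hx => ?_).trans hF
    have hPx : P x = x := Submodule.starProjection_eq_self_iff.2 hx
    simp [hPx]
  refine (charValue_le hr).trans_lt (lt_of_le_of_lt ?_ hlt)
  rw [sub_sub_cancel]
  refine ContinuousLinearMap.opNorm_le_bound _ (norm_nonneg _) fun x => ?_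
  have hFP : F (P x) = 0 := Submodule.starProjection_apply_mem K x
  calc ‖(S * P) x‖ ≤ ‖T (P x)‖ := h (P x)
    _ = ‖(T - F) (P x)‖ := by rw [_root_.sub_apply, hFP, sub_zero]
    _ ≤ ‖T - F‖ * ‖P x‖ := (T - F).le_opNorm _
    _ ≤ ‖T - F‖ * ‖x‖ := by
      gcongr
      exact (P.le_opNorm x).trans (mul_le_of_le_one_left (norm_nonneg x)
        (Submodule.starProjection_norm_le K))

/-- With `P` the projection onto the range of `F`, taking adjoints in `F = P F` gives `F* = F* P`,
whose rank is at most that of `P`. -/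
theorem rank_star_le {F : H →L[ℂ] H} {k : ℕ}
    (hF : LinearMap.rank (F : H →ₗ[ℂ] H) ≤ (k : Cardinal)) :
    LinearMap.rank ((star F : H →L[ℂ] H) : H →ₗ[ℂ] H) ≤ (k : Cardinal) := by
  let W : Submodule ℂ H := (F : H →ₗ[ℂ] H).range
  have : FiniteDimensional ℂ W := by
    apply Module.rank_lt_aleph0_iff.1
    exact hF.trans_lt (Cardinal.natCast_lt_aleph0)
  let P : H →L[ℂ] H := W.starProjection
  have hPF : P * F = F := by
    ext x
    exact Submodule.starProjection_eq_self_iff.2 ⟨x, rfl⟩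
  have hP : star P = P := (isSelfAdjoint_starProjection W).star_eq
  have h : star F = star F * P := by
    conv_lhs => rw [← hPF, star_mul, hP]
  rw [h]
  refine (LinearMap.rank_comp_le_right (P : H →ₗ[ℂ] H) ((star F : H →L[ℂ] H) : H →ₗ[ℂ] H)).trans ?_
  refine (Submodule.rank_mono ?_).trans hF
  rintro _ ⟨x, rfl⟩
  exact Submodule.starProjection_apply_mem W x

theorem charValue_star_le (T : H →L[ℂ] H) (k : ℕ) : charValue (star T) k ≤ charValue T k := by
  refine le_of_forall_pos_lt_add fun ε hε => ?_
  obtain ⟨F, hF, h⟩ := exists_norm_sub_lt T k hε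
  refine (charValue_le (rank_star_le hF)).trans_lt ?_
  rwa [← star_sub, norm_star]

/-- A rank-`k` compression bound: on positive operators, the `k`-th characteristic value is at most
the supremum of the numerical range on the orthogonal complement of any `k`-dimensional space. -/
theorem charValue_le_of_orthogonal {A : H →L[ℂ] H} (hA : 0 ≤ A) (V : Submodule ℂ H)
    [FiniteDimensional ℂ V] {k : ℕ} (hV : Module.finrank ℂ V ≤ k) {c : ℝ} (hc : 0 ≤ c)
    (h : ∀ x ∈ Vᗮ, (inner ℂ (A x) x).re ≤ c * ‖x‖ ^ 2) : charValue A k ≤ c := by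
  let S : H →L[ℂ] H := CFC.sqrt A
  have hSS : S * S = A := CFC.sqrt_mul_sqrt_self A hA
  have hS : star S = S := (IsSelfAdjoint.of_nonneg (CFC.sqrt_nonneg A)).star_eq
  let P : H →L[ℂ] H := V.starProjection
  let Q : H →L[ℂ] H := Vᗮ.starProjection
  have hQ : star Q = Q := (isSelfAdjoint_starProjection Vᗮ).star_eq
  have hQQ : Q * Q = Q := (Submodule.isIdempotentElem_starProjection Vᗮ)
  have hPQ : P + Q = 1 := by
    ext x
    exact Submodule.starProjection_add_starProjection_orthogonal x
  -- The approximant of `A = S²` is `S P S`; the remainder `S Q S = (S Q)(S Q)*` has norm `‖S Q‖²`,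
  -- which the hypothesis on `Vᗮ` controls.
  have hr : LinearMap.rank ((S * (P * S) : H →L[ℂ] H) : H →ₗ[ℂ] H) ≤ (k : Cardinal) := by
    refine (LinearMap.rank_comp_le_right ((P * S : H →L[ℂ] H) : H →ₗ[ℂ] H)
      (S : H →ₗ[ℂ] H)).trans ((Submodule.rank_mono (t := V) ?_).trans ?_)
    · rintro _ ⟨x, rfl⟩
      exact Submodule.starProjection_apply_mem V (S x)
    · rw [← Module.finrank_eq_rank]
      exact_mod_cast hV
  have hdiff : A - S * (P * S) = (S * Q) * star (S * Q) := by
    have hP : P = 1 - Q := eq_sub_of_add_eq hPQ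
    rw [star_mul, hQ, hS, ← hSS, hP]
    calc S * S - S * ((1 - Q) * S) = S * Q * S := by noncomm_ring
      _ = S * (Q * Q) * S := by rw [hQQ]
      _ = S * Q * (Q * S) := by noncomm_ring
  refine (charValue_le hr).trans ?_
  rw [hdiff, CStarRing.norm_self_mul_star]
  have hn : ‖S * Q‖ ≤ √c := by
    refine ContinuousLinearMap.opNorm_le_bound _ (Real.sqrt_nonneg c) fun x => ?_
    rw [← sq_le_sq₀ (norm_nonneg _) (by positivity), mul_pow, Real.sq_sqrt hc]
    have h1 : ‖(S * Q) x‖ ^ 2 = (inner ℂ (A (Q x)) (Q x)).re := by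
      have hadj : inner ℂ (S (S (Q x))) (Q x) = inner ℂ (S (Q x)) (S (Q x)) := by
        conv_lhs => rw [← hS, ContinuousLinearMap.star_eq_adjoint,
          ContinuousLinearMap.adjoint_inner_left]
        rw [← ContinuousLinearMap.star_eq_adjoint, hS]
      rw [← hSS]
      change _ = (inner ℂ (S (S (Q x))) (Q x)).re
      rw [hadj, inner_self_eq_norm_sq_to_K]
      norm_cast
    rw [h1]
    refine (h _ (Submodule.starProjection_apply_mem _ _)).trans ?_
    have : ‖Q x‖ ≤ ‖x‖ := (Q.le_opNorm x).trans (mul_le_of_le_one_left (norm_nonneg x)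
        (Submodule.starProjection_norm_le _))
    gcongr
  calc ‖S * Q‖ * ‖S * Q‖ ≤ √c * √c := by gcongr
    _ = c := Real.mul_self_sqrt hc

end CharacteristicValues

/-! ### Ky Fan's principle and the two inequalities for partial sums -/

section KyFan

variable {H : Type*} [NormedAddCommGroup H] [InnerProductSpace ℂ H]

theorem partialSum_nonneg (T : H →L[ℂ] H) (N : ℕ) : 0 ≤ partialSum T N :=
  Finset.sum_nonneg fun k _ => charValue_nonneg T k

theorem partialSum_mono (T : H →L[ℂ] H) : Monotone (partialSum T) := by
  intro M N h
  exact Finset.sum_le_sum_of_subset_of_nonneg (Finset.range_mono h)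
    fun k _ _ => charValue_nonneg T k

theorem partialSum_succ (T : H →L[ℂ] H) (N : ℕ) :
    partialSum T (N + 1) = partialSum T N + charValue T N :=
  Finset.sum_range_succ _ _

/-- The compression of `A` to a finite-dimensional subspace. -/
def compression (V : Submodule ℂ H) [FiniteDimensional ℂ V] (A : H →L[ℂ] H) : V →ₗ[ℂ] V :=
  (V.orthogonalProjectionOnto : H →ₗ[ℂ] V) ∘ₗ (A : H →ₗ[ℂ] H) ∘ₗ V.subtype

theorem inner_compression (V : Submodule ℂ H) [FiniteDimensional ℂ V] (A : H →L[ℂ] H)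
    (x y : V) : inner ℂ x (compression V A y) = inner ℂ (x : H) (A y) :=
  Submodule.inner_orthogonalProjectionOnto_eq_of_mem_left x (A y)

theorem compression_inner (V : Submodule ℂ H) [FiniteDimensional ℂ V] (A : H →L[ℂ] H)
    (x y : V) : inner ℂ (compression V A x) y = inner ℂ (A x) (y : H) :=
  Submodule.inner_orthogonalProjectionOnto_eq_of_mem_right y (A x)

/-- The real part of the trace of the compression of `A` to a finite-dimensional subspace. -/
def compTrace (V : Submodule ℂ H) [FiniteDimensional ℂ V] (A : H →L[ℂ] H) : ℝ :=
  (LinearMap.trace ℂ V (compression V A)).re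

theorem compTrace_add (V : Submodule ℂ H) [FiniteDimensional ℂ V] (A B : H →L[ℂ] H) :
    compTrace V (A + B) = compTrace V A + compTrace V B := by
  have : compression V (A + B) = compression V A + compression V B := by
    ext x
    simp [compression]
  rw [compTrace, this, map_add, Complex.add_re, compTrace, compTrace]

theorem compTrace_eq_sum (V : Submodule ℂ H) [FiniteDimensional ℂ V] (A : H →L[ℂ] H)
    {ι : Type*} [Fintype ι] (b : OrthonormalBasis ι ℂ V) :
    compTrace V A = ∑ i, (inner ℂ (b i : H) (A (b i))).re := by
  rw [compTrace, LinearMap.trace_eq_sum_inner _ b, Complex.re_sum]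
  simp_rw [inner_compression]

theorem finrank_range_le_of_rank_le {F : H →ₗ[ℂ] H} {k : ℕ} (hF : F.rank ≤ (k : Cardinal)) :
    FiniteDimensional ℂ F.range ∧ Module.finrank ℂ F.range ≤ k :=
  ⟨Module.rank_lt_aleph0_iff.1 (hF.trans_lt Cardinal.natCast_lt_aleph0),
    Module.finrank_le_of_rank_le hF⟩

theorem compression_isPositive (V : Submodule ℂ H) [FiniteDimensional ℂ V] {A : H →L[ℂ] H}
    (hA : 0 ≤ A) : (compression V A).IsPositive := by
  rw [ContinuousLinearMap.nonneg_iff_isPositive] at hA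
  refine ⟨fun x y => ?_, fun x => ?_⟩
  · rw [compression_inner, inner_compression]
    exact hA.1 x y
  · rw [compression_inner]
    exact hA.2 x

/-- The eigenvalues of a compression are bounded by the characteristic values. -/
theorem eigenvalues_compression_le (V : Submodule ℂ H) [FiniteDimensional ℂ V] {A : H →L[ℂ] H}
    (hT : (compression V A).IsSymmetric) {m : ℕ} (hm : Module.finrank ℂ V = m) (i : Fin m) :
    hT.eigenvalues hm i ≤ charValue A i := by
  refine le_csInf (charValue_set_nonempty A i) ?_
  rintro r ⟨F, hF, rfl⟩
  let b := hT.eigenvectorBasis hm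
  -- Courant–Fischer: on the span of the first `i + 1` eigenvectors, `F` of rank at most `i` kills
  -- some nonzero `W c`. There the Rayleigh quotient of `A` is at least the `i`-th eigenvalue, and
  -- `A` agrees with `A - F`.
  let ι : Fin (i + 1) → Fin m := Fin.castLE i.2
  let w : Fin (i + 1) → V := fun j => b (ι j)
  have hw : Orthonormal ℂ w := b.orthonormal.comp ι (Fin.castLE_injective _)
  let W : (Fin (i + 1) → ℂ) →ₗ[ℂ] V := Fintype.linearCombination ℂ w
  have hWc : ∀ c, W c = ∑ j, c j • w j := fun c => Fintype.linearCombination_apply ℂ w c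
  let G : (Fin (i + 1) → ℂ) →ₗ[ℂ] H := (F : H →ₗ[ℂ] H) ∘ₗ V.subtype ∘ₗ W
  obtain ⟨hfd, hfr⟩ := finrank_range_le_of_rank_le hF
  have hG : Module.finrank ℂ G.range ≤ i :=
    (Submodule.finrank_mono (LinearMap.range_comp_le_range _ _)).trans hfr
  have hker : G.ker ≠ ⊥ := by
    intro h
    have h1 := G.finrank_range_add_finrank_ker
    rw [h, finrank_bot, Module.finrank_fin_fun] at h1
    omega
  obtain ⟨c, hc, hc0⟩ := Submodule.exists_mem_ne_zero_of_ne_bot hker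
  have hFx : F (W c : H) = 0 := hc
  have hnorm : ‖W c‖ ^ 2 = ∑ j, ‖c j‖ ^ 2 := by
    have h1 := hw.inner_sum c c Finset.univ
    rw [← hWc, inner_self_eq_norm_sq_to_K] at h1
    simp_rw [Complex.conj_mul'] at h1
    refine Complex.ofReal_injective ?_
    push_cast
    exact h1
  have hpos : 0 < ∑ j, ‖c j‖ ^ 2 := by
    obtain ⟨j, hj⟩ := Function.ne_iff.1 hc0
    exact Finset.sum_pos' (fun _ _ => by positivity)
      ⟨j, Finset.mem_univ j, by have := norm_pos_iff.2 hj; positivity⟩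
  have hTx : compression V A (W c) = ∑ j, (c j * (hT.eigenvalues hm (ι j) : ℂ)) • w j := by
    rw [hWc, map_sum]
    refine Finset.sum_congr rfl fun j _ => ?_
    rw [map_smul, hT.apply_eigenvectorBasis hm, smul_smul]
    rfl
  have hin : inner ℂ (W c) (compression V A (W c)) =
      ((∑ j, hT.eigenvalues hm (ι j) * ‖c j‖ ^ 2 : ℝ) : ℂ) := by
    rw [hTx]
    conv_lhs => rw [hWc]
    rw [hw.inner_sum]
    push_cast
    refine Finset.sum_congr rfl fun j _ => ?_
    rw [← mul_assoc, Complex.conj_mul', mul_comm]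
  have hlow : hT.eigenvalues hm i * ∑ j, ‖c j‖ ^ 2 ≤
      ∑ j, hT.eigenvalues hm (ι j) * ‖c j‖ ^ 2 := by
    rw [Finset.mul_sum]
    refine Finset.sum_le_sum fun j _ => mul_le_mul_of_nonneg_right ?_ (by positivity)
    refine hT.eigenvalues_antitone hm ?_
    exact Fin.le_def.2 (Nat.lt_succ_iff.1 j.2)
  have hup : ∑ j, hT.eigenvalues hm (ι j) * ‖c j‖ ^ 2 ≤ ‖A - F‖ * ∑ j, ‖c j‖ ^ 2 := by
    have h1 : ((∑ j, hT.eigenvalues hm (ι j) * ‖c j‖ ^ 2 : ℝ) : ℂ) =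
        inner ℂ (W c : H) ((A - F) (W c : H)) := by
      rw [← hin, inner_compression, _root_.sub_apply, hFx, sub_zero]
    have h2 := congrArg Complex.re h1
    rw [Complex.ofReal_re] at h2
    rw [h2, ← hnorm]
    calc (inner ℂ (W c : H) ((A - F) (W c : H))).re
        ≤ ‖(W c : H)‖ * ‖(A - F) (W c : H)‖ := re_inner_le_norm (𝕜 := ℂ) _ _
      _ ≤ ‖(W c : H)‖ * (‖A - F‖ * ‖(W c : H)‖) := by
        gcongr
        exact (A - F).le_opNorm _
      _ = ‖A - F‖ * ‖W c‖ ^ 2 := by rw [Submodule.coe_norm]; ring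
  exact le_of_mul_le_mul_right (hlow.trans hup) hpos

/-- The trace is the sum of the eigenvalues of the compression, each dominated by the characteristic
value of the same index: the upper half of Ky Fan's principle. -/
theorem compTrace_le_partialSum (V : Submodule ℂ H) [FiniteDimensional ℂ V] {A : H →L[ℂ] H}
    (hA : 0 ≤ A) {N : ℕ} (hN : Module.finrank ℂ V ≤ N) : compTrace V A ≤ partialSum A N := by
  have hT := (compression_isPositive V hA).1
  refine le_trans ?_ (partialSum_mono A hN)
  rw [compTrace, hT.trace_eq_sum_eigenvalues rfl, partialSum, Finset.sum_range]
  change ∑ i, hT.eigenvalues rfl i ≤ _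
  exact Finset.sum_le_sum fun i _ => eigenvalues_compression_le V hT rfl i

/-- In an eigenbasis of the compression, the left side weights each eigenvalue by a number that is
at most `1` by Bessel, and the eigenvalues are nonnegative. -/
theorem sum_inner_le_compTrace (V : Submodule ℂ H) [FiniteDimensional ℂ V] {A : H →L[ℂ] H}
    (hA : 0 ≤ A) {ι : Type*} [Fintype ι] {e : ι → V} (he : Orthonormal ℂ e) :
    ∑ i, (inner ℂ (e i : H) (A (e i))).re ≤ compTrace V A := by
  have hpos := compression_isPositive V hA
  have hT := hpos.1
  let b := hT.eigenvectorBasis rfl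
  have h1 : ∀ i, (inner ℂ (e i : H) (A (e i))).re =
      ∑ j, hT.eigenvalues rfl j * ‖inner ℂ (e i) (b j)‖ ^ 2 := by
    intro i
    rw [← inner_compression, ← b.sum_inner_mul_inner, Complex.re_sum]
    refine Finset.sum_congr rfl fun j _ => ?_
    rw [← hT, hT.apply_eigenvectorBasis, inner_smul_left]
    have : inner ℂ (hT.eigenvectorBasis rfl j) (e i) = star (inner ℂ (e i) (b j)) :=
      (inner_conj_symm _ _).symm
    rw [this, mul_left_comm, Complex.star_def, Complex.mul_conj', RCLike.conj_ofReal]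
    change ((hT.eigenvalues rfl j : ℂ) * _).re = _
    rw [Complex.re_ofReal_mul, ← Complex.ofReal_pow, Complex.ofReal_re]
  simp_rw [h1]
  rw [Finset.sum_comm, compTrace, hT.trace_eq_sum_eigenvalues rfl]
  refine Finset.sum_le_sum fun j _ => ?_
  rw [← Finset.mul_sum]
  refine mul_le_of_le_one_right (hpos.nonneg_eigenvalues rfl j) ?_
  have h2 := he.sum_inner_products_le (b j) (s := Finset.univ)
  rwa [b.orthonormal.1 j, one_pow] at h2

theorem compTrace_mono {V W : Submodule ℂ H} [FiniteDimensional ℂ V] [FiniteDimensional ℂ W]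
    (h : V ≤ W) {A : H →L[ℂ] H} (hA : 0 ≤ A) : compTrace V A ≤ compTrace W A := by
  rw [compTrace_eq_sum V A (stdOrthonormalBasis ℂ V)]
  have he : Orthonormal ℂ fun i => Submodule.inclusion h (stdOrthonormalBasis ℂ V i) := by
    have := (stdOrthonormalBasis ℂ V).orthonormal
    rw [orthonormal_iff_ite] at this ⊢
    exact this
  exact sum_inner_le_compTrace W hA he

theorem compTrace_add_le_of_orthogonal (V : Submodule ℂ H) [FiniteDimensional ℂ V]
    {A : H →L[ℂ] H} (hA : 0 ≤ A) {x : H} (hx : ‖x‖ = 1) (hxV : x ∈ Vᗮ) :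
    compTrace V A + (inner ℂ x (A x)).re ≤ compTrace (V ⊔ Submodule.span ℂ {x}) A := by
  let b := stdOrthonormalBasis ℂ V
  let W := V ⊔ Submodule.span ℂ {x}
  let e : Option (Fin (Module.finrank ℂ V)) → W := fun o =>
    o.elim ⟨x, (le_sup_right : _ ≤ W) (Submodule.mem_span_singleton_self x)⟩
      fun i => ⟨b i, (le_sup_left : V ≤ W) (b i).2⟩
  have he : Orthonormal ℂ e := by
    have hb := orthonormal_iff_ite.1 b.orthonormal
    rw [orthonormal_iff_ite]
    rintro (_ | i) (_ | j)
    · change inner ℂ x x = _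
      rw [inner_self_eq_norm_sq_to_K, hx]
      simp
    · change inner ℂ x (b j : H) = _
      rw [Submodule.inner_left_of_mem_orthogonal (b j).2 hxV]
      simp
    · change inner ℂ (b i : H) x = _
      rw [Submodule.inner_right_of_mem_orthogonal (b i).2 hxV]
      simp
    · change inner ℂ (b i : H) (b j : H) = _
      simpa using hb i j
  have h := sum_inner_le_compTrace W hA he
  rw [Fintype.sum_option] at h
  rw [compTrace_eq_sum V A b, add_comm]
  exact h

variable [CompleteSpace H]

/-- The lower half of Ky Fan's principle, by a greedy choice: `charValue_le_of_orthogonal` supplies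
a unit vector of `Vᗮ` on which `A` nearly reaches `μ_N`. Each new vector costs at most `ε`, and no
compactness or spectral theorem for `A` is needed. -/
theorem exists_le_compTrace {A : H →L[ℂ] H} (hA : 0 ≤ A) {ε : ℝ} (hε : 0 < ε) (N : ℕ) :
    ∃ (V : Submodule ℂ H) (_ : FiniteDimensional ℂ V), Module.finrank ℂ V ≤ N ∧
      partialSum A N - N * ε ≤ compTrace V A := by
  induction N with
  | zero =>
    refine ⟨⊥, inferInstance, by simp, ?_⟩
    rw [compTrace_eq_sum _ A (stdOrthonormalBasis ℂ _)]
    simp only [partialSum, Finset.range_zero, Finset.sum_empty, Nat.cast_zero, zero_mul, sub_zero]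
    exact Finset.sum_nonneg fun i _ =>
      ((ContinuousLinearMap.nonneg_iff_isPositive A).1 hA).re_inner_nonneg_right _
  | succ N ih =>
    obtain ⟨V, hV, hdim, htr⟩ := ih
    rw [partialSum_succ]
    push_cast
    -- `charValue_le_of_orthogonal` needs `0 ≤ μ_N - ε`; otherwise keeping `V` unchanged already
    -- loses no more than `ε`.
    rcases le_or_gt (charValue A N) ε with h | h
    · exact ⟨V, hV, hdim.trans N.le_succ, by linarith⟩
    have hex : ∃ x ∈ Vᗮ, (charValue A N - ε) * ‖x‖ ^ 2 < (inner ℂ (A x) x).re := by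
      by_contra! hcon
      have := charValue_le_of_orthogonal hA V hdim (sub_nonneg.2 h.le) hcon
      linarith
    obtain ⟨x, hxV, hx⟩ := hex
    have hx0 : x ≠ 0 := by
      rintro rfl
      simp at hx
    have hn : 0 < ‖x‖ := norm_pos_iff.2 hx0
    let y : H := ((‖x‖⁻¹ : ℝ) : ℂ) • x
    have hy : ‖y‖ = 1 := by
      rw [norm_smul, Complex.norm_real, norm_inv, norm_norm, inv_mul_cancel₀ hn.ne']
    have hyA : charValue A N - ε ≤ (inner ℂ y (A y)).re := by
      rw [map_smul, inner_smul_left, inner_smul_right, Complex.conj_ofReal, Complex.re_ofReal_mul,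
        Complex.re_ofReal_mul, ← inner_conj_symm, Complex.conj_re, ← mul_assoc, ← mul_inv, ← sq,
        inv_mul_eq_div, le_div_iff₀ (by positivity)]
      exact hx.le
    refine ⟨V ⊔ Submodule.span ℂ {y}, inferInstance, ?_, ?_⟩
    · refine (Submodule.finrank_add_le_finrank_add_finrank _ _).trans (add_le_add hdim ?_)
      exact finrank_span_le_card _ |>.trans (by simp)
    · have := compTrace_add_le_of_orthogonal V hA hy (Vᗮ.smul_mem _ hxV)
      linarith

/-- A subspace nearly optimal for `A + B` is a test space for both `A` and `B`. -/
theorem partialSum_add_le {A B : H →L[ℂ] H} (hA : 0 ≤ A) (hB : 0 ≤ B) (N : ℕ) :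
    partialSum (A + B) N ≤ partialSum A N + partialSum B N := by
  refine le_of_forall_pos_le_add fun δ hδ => ?_
  obtain ⟨V, _, hV, h⟩ := exists_le_compTrace (add_nonneg hA hB)
    (ε := δ / (N + 1)) (by positivity) N
  have h1 := compTrace_le_partialSum V hA hV
  have h2 := compTrace_le_partialSum V hB hV
  rw [compTrace_add] at h
  have h3 : N * (δ / (N + 1)) ≤ δ := by
    rw [← mul_div_assoc, div_le_iff₀ (by positivity)]
    nlinarith
  linarith

/-- If `V` is nearly optimal for `A` and `W` for `B`, then `V ⊔ W` has dimension at most `2N` and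
tests `A + B`. -/
theorem partialSum_add_partialSum_le {A B : H →L[ℂ] H} (hA : 0 ≤ A) (hB : 0 ≤ B) (N : ℕ) :
    partialSum A N + partialSum B N ≤ partialSum (A + B) (2 * N) := by
  refine le_of_forall_pos_le_add fun δ hδ => ?_
  have hε : 0 < δ / (2 * (N + 1)) := by positivity
  obtain ⟨V, _, hV, h⟩ := exists_le_compTrace hA hε N
  obtain ⟨W, _, hW, h'⟩ := exists_le_compTrace hB hε N
  have h1 := compTrace_le_partialSum (V ⊔ W) (add_nonneg hA hB) (N := 2 * N)
    ((Submodule.finrank_add_le_finrank_add_finrank _ _).trans (by omega))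
  rw [compTrace_add] at h1
  have h2 := compTrace_mono (le_sup_left : V ≤ V ⊔ W) hA
  have h3 := compTrace_mono (le_sup_right : W ≤ V ⊔ W) hB
  have h4 : 2 * (N * (δ / (2 * (N + 1)))) ≤ δ := by
    rw [← mul_div_assoc, ← mul_div_assoc, div_le_iff₀ (by positivity)]
    nlinarith
  linarith

end KyFan

/-! ### Ideal properties and the Dixmier limit of partial sums -/

section Ideal

/-- Each block of `m` consecutive terms is at most `m` times its first. This converts bounds at the
indices `m * k`, which sums and products of operators produce, into bounds on partial sums. -/
theorem sum_range_mul_le {f : ℕ → ℝ} (hf : Antitone f) (m N : ℕ) :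
    ∑ k ∈ Finset.range (m * N), f k ≤ m * ∑ k ∈ Finset.range N, f (m * k) := by
  induction N with
  | zero => simp
  | succ N ih =>
    rw [Nat.mul_succ, Finset.sum_range_add, Finset.sum_range_succ, mul_add]
    refine add_le_add ih ?_
    calc ∑ j ∈ Finset.range m, f (m * N + j) ≤ ∑ _j ∈ Finset.range m, f (m * N) :=
          Finset.sum_le_sum fun j _ => hf (Nat.le_add_right _ _)
      _ = m * f (m * N) := by simp

variable {H : Type*} [NormedAddCommGroup H] [InnerProductSpace ℂ H]

theorem partialSum_mul_le (T : H →L[ℂ] H) (m N : ℕ) :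
    partialSum T (m * N) ≤ m * ∑ k ∈ Finset.range N, charValue T (m * k) :=
  sum_range_mul_le (charValue_antitone T) m N

/-- Valid without positivity, at the price of the factor `2`: enough for the ideal property, not for
additivity of the Dixmier trace. -/
theorem partialSum_add_le_two_mul (S T : H →L[ℂ] H) (N : ℕ) :
    partialSum (S + T) N ≤ 2 * (partialSum S N + partialSum T N) := by
  refine (partialSum_mono _ (by omega : N ≤ 2 * N)).trans ((partialSum_mul_le _ 2 N).trans ?_)
  rw [partialSum, partialSum, ← Finset.sum_add_distrib, Nat.cast_two]
  refine mul_le_mul_of_nonneg_left (Finset.sum_le_sum fun k _ => ?_) zero_le_two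
  rw [two_mul]
  exact charValue_add_le S T k k

theorem partialSum_smul (c : ℂ) (T : H →L[ℂ] H) (N : ℕ) :
    partialSum (c • T) N = ‖c‖ * partialSum T N := by
  simp_rw [partialSum, charValue_smul, Finset.mul_sum]

theorem partialSum_mul_left_le (X T : H →L[ℂ] H) (N : ℕ) :
    partialSum (X * T) N ≤ ‖X‖ * partialSum T N := by
  rw [partialSum, partialSum, Finset.mul_sum]
  exact Finset.sum_le_sum fun k _ => charValue_mul_left_le X T k

theorem partialSum_mul_right_le (T X : H →L[ℂ] H) (N : ℕ) :
    partialSum (T * X) N ≤ ‖X‖ * partialSum T N := by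
  rw [partialSum, partialSum, Finset.mul_sum]
  refine Finset.sum_le_sum fun k _ => ?_
  rw [mul_comm]
  exact charValue_mul_right_le T X k

theorem MemIdeal.of_partialSum_le {p : ℝ} {S T : H →L[ℂ] H} (hT : MemIdeal p T) {c : ℝ}
    (hc : 0 ≤ c) (h : ∀ N, partialSum S N ≤ c * partialSum T N) : MemIdeal p S := by
  obtain ⟨C, hC⟩ := hT
  refine ⟨c * C, fun N => (h N).trans ?_⟩
  rw [mul_assoc]
  exact mul_le_mul_of_nonneg_left (hC N) hc

theorem MemIdeal.add {p : ℝ} {S T : H →L[ℂ] H} (hS : MemIdeal p S) (hT : MemIdeal p T) :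
    MemIdeal p (S + T) := by
  obtain ⟨C, hC⟩ := hS
  obtain ⟨C', hC'⟩ := hT
  refine ⟨2 * (C + C'), fun N => (partialSum_add_le_two_mul S T N).trans ?_⟩
  have h1 := hC N
  have h2 := hC' N
  linarith

theorem MemIdeal.mul_left {p : ℝ} {T : H →L[ℂ] H} (hT : MemIdeal p T) (X : H →L[ℂ] H) :
    MemIdeal p (X * T) :=
  hT.of_partialSum_le (norm_nonneg X) (partialSum_mul_left_le X T)

theorem MemIdeal.mul_right {p : ℝ} {T : H →L[ℂ] H} (hT : MemIdeal p T) (X : H →L[ℂ] H) :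
    MemIdeal p (T * X) :=
  hT.of_partialSum_le (norm_nonneg X) (partialSum_mul_right_le T X)

theorem MemIdeal.smul {p : ℝ} {T : H →L[ℂ] H} (hT : MemIdeal p T) (c : ℂ) :
    MemIdeal p (c • T) :=
  hT.of_partialSum_le (norm_nonneg c) fun N => (partialSum_smul c T N).le

theorem partialSum_real_smul {c : ℝ} (hc : 0 ≤ c) (T : H →L[ℂ] H) (N : ℕ) :
    partialSum (c • T) N = c * partialSum T N := by
  rw [← Complex.coe_smul, partialSum_smul, Complex.norm_real, Real.norm_of_nonneg hc]

theorem MemIdeal.real_smul {p : ℝ} {T : H →L[ℂ] H} (hT : MemIdeal p T) (c : ℝ) :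
    MemIdeal p (c • T) := by
  rw [← Complex.coe_smul]
  exact hT.smul _

theorem log_add_two_pos (i : ℕ) : 0 < Real.log ((i : ℝ) + 2) :=
  Real.log_pos (by have : (0 : ℝ) ≤ i := i.cast_nonneg; linarith)

theorem logMean_nonneg (T : H →L[ℂ] H) (i : ℕ) : 0 ≤ logMean T i :=
  div_nonneg (partialSum_nonneg _ _) (log_add_two_pos i).le

theorem MemIdeal.logMean_bounded {T : H →L[ℂ] H} (hT : MemIdeal 1 T) :
    ∃ f : ℕ →ᵇ ℝ, ∀ i, f i = logMean T i := by
  obtain ⟨C, hC⟩ := hT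
  have hC0 : 0 ≤ C := by
    have h1 := (partialSum_nonneg T 1).trans (hC 1)
    simpa using h1
  have hb : ∀ i, ‖logMean T i‖ ≤ C * (1 / Real.log 2 + 1) := by
    intro i
    have hlog := log_add_two_pos i
    rw [Real.norm_of_nonneg (logMean_nonneg T i), logMean, div_le_iff₀ hlog]
    refine (hC (i + 2)).trans ?_
    rw [mul_assoc]
    refine mul_le_mul_of_nonneg_left ?_ hC0
    -- For `p = 1` the comparison sum is a harmonic number, at most `1 + log`. As the sequence
    -- starts at `N = 2`, the `1` is absorbed by `log N / log 2`.
    have h1 : ∑ k ∈ Finset.range (i + 2), ((k : ℝ) + 1) ^ (-(1 / (1 : ℝ))) =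
        (harmonic (i + 2) : ℝ) := by
      rw [harmonic]
      push_cast
      refine Finset.sum_congr rfl fun k _ => ?_
      rw [div_one, Real.rpow_neg_one]
    have h2 := harmonic_le_one_add_log (i + 2)
    push_cast at h2
    have h3 : Real.log 2 ≤ Real.log ((i : ℝ) + 2) :=
      Real.log_le_log two_pos (by have : (0 : ℝ) ≤ i := i.cast_nonneg; linarith)
    have h4 : 1 ≤ 1 / Real.log 2 * Real.log ((i : ℝ) + 2) := by
      rw [one_div, inv_mul_eq_div, one_le_div (Real.log_pos one_lt_two)]
      exact h3
    rw [h1, add_mul, one_mul]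
    linarith
  exact ⟨BoundedContinuousFunction.ofNormedAddCommGroupDiscrete (logMean T) _ hb, fun i => rfl⟩

/-- The bound chosen in the definition of `dixmierPos` is immaterial: only the values of the
sequence matter. -/
theorem dixmierPos_eq (ω : DixmierLimit) {T : H →L[ℂ] H} {f : ℕ →ᵇ ℝ}
    (hf : ∀ i, f i = logMean T i) : dixmierPos ω T = ω.lim f := by
  have h : ∃ C : ℝ, ∀ i, ‖logMean T i‖ ≤ C := ⟨‖f‖, fun i => hf i ▸ f.norm_coe_le_norm i⟩
  rw [dixmierPos, dif_pos h]
  congr 1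
  ext i
  exact (hf i).symm

theorem DixmierLimit.lim_mono (ω : DixmierLimit) {f g : ℕ →ᵇ ℝ} (h : ∀ i, f i ≤ g i) :
    ω.lim f ≤ ω.lim g := by
  have := ω.nonneg (g - f) fun i => sub_nonneg.2 (h i)
  rwa [map_sub, sub_nonneg] at this

theorem DixmierLimit.lim_eq_of_tendsto_sub (ω : DixmierLimit) {f g : ℕ →ᵇ ℝ}
    (h : Tendsto (fun i => f i - g i) atTop (𝓝 0)) : ω.lim f = ω.lim g := by
  have := ω.eq_of_tendsto (f - g) 0 h
  rwa [map_sub, sub_eq_zero] at this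

theorem dixmierPos_congr (ω : DixmierLimit) {S T : H →L[ℂ] H} (hT : MemIdeal 1 T)
    (h : ∀ k, charValue S k = charValue T k) : dixmierPos ω S = dixmierPos ω T := by
  obtain ⟨f, hf⟩ := hT.logMean_bounded
  rw [dixmierPos_eq ω hf]
  refine dixmierPos_eq ω fun i => ?_
  simp_rw [hf, logMean, partialSum, h]

theorem dixmierPos_smul (ω : DixmierLimit) {c : ℝ} (hc : 0 ≤ c) {T : H →L[ℂ] H}
    (hT : MemIdeal 1 T) : dixmierPos ω (c • T) = c * dixmierPos ω T := by
  obtain ⟨f, hf⟩ := hT.logMean_bounded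
  rw [dixmierPos_eq ω hf, ← smul_eq_mul, ← map_smul]
  refine dixmierPos_eq ω fun i => ?_
  rw [BoundedContinuousFunction.smul_apply, hf, logMean, logMean, partialSum_real_smul hc,
    smul_eq_mul, mul_div_assoc]

theorem tendsto_log_add_two : Tendsto (fun i : ℕ => Real.log ((i : ℝ) + 2)) atTop atTop :=
  Real.tendsto_log_atTop.comp
    (tendsto_atTop_add_const_right _ _ tendsto_natCast_atTop_atTop)

theorem dixmierPos_eq_zero (ω : DixmierLimit) {T : H →L[ℂ] H} {C : ℝ}
    (h : ∀ N, partialSum T N ≤ C) : dixmierPos ω T = 0 := by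
  have hlim : Tendsto (logMean T) atTop (𝓝 0) := by
    refine squeeze_zero (logMean_nonneg T) (fun i => ?_) (tendsto_log_add_two.const_div_atTop C)
    exact div_le_div_of_nonneg_right (h _) (log_add_two_pos i).le
  have hT : ∃ C : ℝ, ∀ i, ‖logMean T i‖ ≤ C := by
    obtain ⟨C, hC⟩ := hlim.norm.bddAbove_range
    exact ⟨C, fun i => hC ⟨i, rfl⟩⟩
  obtain ⟨C', hC'⟩ := hT
  rw [dixmierPos_eq ω (f := BoundedContinuousFunction.ofNormedAddCommGroupDiscrete (logMean T)
    C' hC') fun i => rfl]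
  exact ω.eq_of_tendsto _ 0 hlim

theorem log_add_two_sub_log_half_le (i : ℕ) :
    Real.log ((i : ℝ) + 2) - Real.log (((i / 2 : ℕ) : ℝ) + 2) ≤ Real.log 2 := by
  have h0 : (0 : ℝ) ≤ ((i / 2 : ℕ) : ℝ) := Nat.cast_nonneg _
  rw [sub_le_iff_le_add, ← Real.log_mul two_ne_zero (by positivity)]
  refine Real.log_le_log (by positivity) ?_
  have h : i ≤ 2 * (i / 2) + 1 := by omega
  have h' : (i : ℝ) ≤ 2 * ((i / 2 : ℕ) : ℝ) + 1 := by exact_mod_cast h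
  linarith

theorem tendsto_div_two_nat : Tendsto (fun i : ℕ => i / 2) atTop atTop :=
  Nat.tendsto_div_const_atTop two_ne_zero

/-- Dilation invariance compares the Dixmier means of `σ_{2N}` and of `σ_N`. -/
theorem lim_partialSum_two_mul (ω : DixmierLimit) {T : H →L[ℂ] H} {f g : ℕ →ᵇ ℝ}
    (hf : ∀ i, f i = logMean T i)
    (hg : ∀ i : ℕ, g i = partialSum T (2 * (i + 2)) / Real.log ((i : ℝ) + 2)) :
    ω.lim g = ω.lim f := by
  let g' : ℕ →ᵇ ℝ := BoundedContinuousFunction.ofNormedAddCommGroupDiscrete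
    (fun i => g (i / 2)) ‖g‖ fun i => g.norm_coe_le_norm _
  rw [← ω.dilation g g' fun i => rfl]
  -- After dilation the index `2 * (i / 2 + 2)` is `i + 3` or `i + 4`, so the numerator exceeds
  -- `σ_{i+2}` by at most `2‖T‖`; the logarithms differ by at most `log 2`. Divided by the
  -- logarithm, both errors vanish in the limit.
  refine ω.lim_eq_of_tendsto_sub ?_
  have hhalf : Tendsto (fun i : ℕ => Real.log (((i / 2 : ℕ) : ℝ) + 2)) atTop atTop :=
    tendsto_log_add_two.comp tendsto_div_two_nat
  have hlim := hhalf.const_div_atTop (2 * ‖T‖ + ‖f‖ * Real.log 2)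
  have hs : ∀ i, partialSum T (i + 2) ≤ partialSum T (2 * (i / 2 + 2)) := fun i =>
    partialSum_mono T (by omega)
  have hlogs : ∀ i : ℕ, Real.log (((i / 2 : ℕ) : ℝ) + 2) ≤ Real.log ((i : ℝ) + 2) := fun i =>
    Real.log_le_log (by positivity) (by gcongr; exact Nat.div_le_self i 2)
  refine squeeze_zero (fun i => ?_) (fun i => ?_) hlim
  · change 0 ≤ g (i / 2) - f i
    rw [sub_nonneg, hg, hf, logMean]
    exact div_le_div₀ (partialSum_nonneg _ _) (hs i) (log_add_two_pos _) (hlogs i)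
  · change g (i / 2) - f i ≤ _
    have hl := log_add_two_pos i
    have hl' := log_add_two_pos (i / 2)
    have h1 : partialSum T (2 * (i / 2 + 2)) ≤ partialSum T (i + 2) + 2 * ‖T‖ := by
      refine (partialSum_mono T (by omega : _ ≤ i + 2 + 1 + 1)).trans ?_
      rw [partialSum_succ, partialSum_succ]
      have := charValue_le_norm T (i + 2)
      have := charValue_le_norm T (i + 2 + 1)
      linarith
    have h2 : partialSum T (i + 2) = f i * Real.log ((i : ℝ) + 2) := by
      rw [hf, logMean, div_mul_cancel₀ _ hl.ne']
    have h3 : f i * (Real.log ((i : ℝ) + 2) - Real.log (((i / 2 : ℕ) : ℝ) + 2)) ≤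
        ‖f‖ * Real.log 2 :=
      mul_le_mul ((Real.le_norm_self _).trans (f.norm_coe_le_norm i))
        (log_add_two_sub_log_half_le i) (sub_nonneg.2 (hlogs i)) (norm_nonneg f)
    rw [hg, tsub_le_iff_right, div_le_iff₀ hl', add_mul, div_mul_cancel₀ _ hl'.ne']
    linarith

end Ideal

/-! ### Linearity and the trace property of the Dixmier trace -/

section Trace

variable {H : Type*} [NormedAddCommGroup H] [InnerProductSpace ℂ H] [CompleteSpace H]

theorem dixmierPos_add (ω : DixmierLimit) {A B : H →L[ℂ] H} (hA : 0 ≤ A) (hB : 0 ≤ B)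
    (hA' : MemIdeal 1 A) (hB' : MemIdeal 1 B) :
    dixmierPos ω (A + B) = dixmierPos ω A + dixmierPos ω B := by
  obtain ⟨f, hf⟩ := hA'.logMean_bounded
  obtain ⟨g, hg⟩ := hB'.logMean_bounded
  obtain ⟨h, hh⟩ := (hA'.add hB').logMean_bounded
  rw [dixmierPos_eq ω hf, dixmierPos_eq ω hg, dixmierPos_eq ω hh, ← map_add]
  apply le_antisymm
  · refine ω.lim_mono fun i => ?_
    rw [BoundedContinuousFunction.add_apply, hf, hg, hh, logMean, logMean, logMean, ← add_div]
    exact div_le_div_of_nonneg_right (partialSum_add_le hA hB _) (log_add_two_pos i).le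
  -- The doubled sequence must be bounded before the limit applies to it; this is `σ_{2N} ≤ 2 σ_N`.
  -- Dilation invariance then gives it the same limit as `h`.
  · have hb : ∀ i : ℕ, ‖partialSum (A + B) (2 * (i + 2)) / Real.log ((i : ℝ) + 2)‖ ≤
        2 * ‖h‖ := by
      intro i
      have hl := log_add_two_pos i
      rw [Real.norm_of_nonneg (div_nonneg (partialSum_nonneg _ _) hl.le), div_le_iff₀ hl]
      have h1 : partialSum (A + B) (2 * (i + 2)) ≤ 2 * partialSum (A + B) (i + 2) := by
        refine (partialSum_mul_le _ 2 (i + 2)).trans ?_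
        rw [Nat.cast_two]
        refine mul_le_mul_of_nonneg_left (Finset.sum_le_sum fun k _ => ?_) zero_le_two
        exact charValue_antitone _ (by omega)
      have h2 : partialSum (A + B) (i + 2) = h i * Real.log ((i : ℝ) + 2) := by
        rw [hh, logMean, div_mul_cancel₀ _ hl.ne']
      have h3 : h i * Real.log ((i : ℝ) + 2) ≤ ‖h‖ * Real.log ((i : ℝ) + 2) :=
        mul_le_mul_of_nonneg_right ((Real.le_norm_self _).trans (h.norm_coe_le_norm i)) hl.le
      linarith
    let u : ℕ →ᵇ ℝ := BoundedContinuousFunction.ofNormedAddCommGroupDiscrete _ _ hb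
    rw [← lim_partialSum_two_mul ω (g := u) hh fun i => rfl]
    refine ω.lim_mono fun i => ?_
    rw [BoundedContinuousFunction.add_apply, hf, hg, logMean, logMean, ← add_div]
    exact div_le_div_of_nonneg_right (partialSum_add_partialSum_le hA hB _)
      (log_add_two_pos i).le

/-- `A⁺ x` and `A⁻ x` are orthogonal, so Pythagoras applies to `A x = A⁺ x - A⁻ x`. Hence both parts
stay in every ideal containing `A`. -/
theorem norm_posPart_apply_le {A : H →L[ℂ] H} (hA : IsSelfAdjoint A) (x : H) :
    ‖A⁺ x‖ ≤ ‖A x‖ ∧ ‖A⁻ x‖ ≤ ‖A x‖ := by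
  have hdec : A x = A⁺ x - A⁻ x := by
    conv_lhs => rw [← CFC.posPart_sub_negPart A hA]
    rfl
  have horth : inner ℂ (A⁺ x) (A⁻ x) = 0 := by
    have hs : ((A⁺ : H →L[ℂ] H) : H →ₗ[ℂ] H).IsSymmetric :=
      ((ContinuousLinearMap.nonneg_iff_isPositive _).1 (CFC.posPart_nonneg A)).1
    have h0 : A⁺ (A⁻ x) = 0 := DFunLike.congr_fun (CFC.posPart_mul_negPart A) x
    have h1 := hs x (A⁻ x)
    simp only [ContinuousLinearMap.coe_coe] at h1
    rw [h1, h0, inner_zero_right]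
  have hpyth := norm_sub_sq (𝕜 := ℂ) (A⁺ x) (A⁻ x)
  rw [← hdec, horth, map_zero, mul_zero, sub_zero] at hpyth
  constructor
  · exact (sq_le_sq₀ (norm_nonneg _) (norm_nonneg _)).1 (by have := sq_nonneg ‖A⁻ x‖; linarith)
  · exact (sq_le_sq₀ (norm_nonneg _) (norm_nonneg _)).1 (by have := sq_nonneg ‖A⁺ x‖; linarith)

theorem partialSum_posPart_le {A : H →L[ℂ] H} (hA : IsSelfAdjoint A) (N : ℕ) :
    partialSum A⁺ N ≤ partialSum A N :=
  Finset.sum_le_sum fun k _ =>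
    charValue_le_of_norm_apply_le (fun x => (norm_posPart_apply_le hA x).1) k

theorem partialSum_negPart_le {A : H →L[ℂ] H} (hA : IsSelfAdjoint A) (N : ℕ) :
    partialSum A⁻ N ≤ partialSum A N :=
  Finset.sum_le_sum fun k _ =>
    charValue_le_of_norm_apply_le (fun x => (norm_posPart_apply_le hA x).2) k

theorem MemIdeal.posPart {p : ℝ} {A : H →L[ℂ] H} (hA : MemIdeal p A) (hs : IsSelfAdjoint A) :
    MemIdeal p A⁺ :=
  hA.of_partialSum_le zero_le_one fun N => by
    rw [one_mul]
    exact partialSum_posPart_le hs N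

theorem MemIdeal.negPart {p : ℝ} {A : H →L[ℂ] H} (hA : MemIdeal p A) (hs : IsSelfAdjoint A) :
    MemIdeal p A⁻ :=
  hA.of_partialSum_le zero_le_one fun N => by
    rw [one_mul]
    exact partialSum_negPart_le hs N

theorem partialSum_realPart_le (T : H →L[ℂ] H) (N : ℕ) :
    partialSum (ℜ T : H →L[ℂ] H) N ≤ 2 * partialSum T N := by
  rw [realPart_apply_coe, partialSum_real_smul (by norm_num)]
  have h1 := partialSum_add_le_two_mul T (star T) N
  have h2 : partialSum (star T) N ≤ partialSum T N :=
    Finset.sum_le_sum fun k _ => charValue_star_le T k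
  linarith

theorem partialSum_imaginaryPart_le (T : H →L[ℂ] H) (N : ℕ) :
    partialSum (ℑ T : H →L[ℂ] H) N ≤ 2 * partialSum T N := by
  have h : ℜ (-Complex.I • T) = ℑ T := by rw [neg_smul, map_neg, realPart_I_smul, neg_neg]
  rw [← h]
  refine (partialSum_realPart_le _ N).trans_eq ?_
  rw [partialSum_smul, norm_neg, Complex.norm_I, one_mul]

theorem MemIdeal.realPart {p : ℝ} {T : H →L[ℂ] H} (hT : MemIdeal p T) :
    MemIdeal p (ℜ T : H →L[ℂ] H) :=
  hT.of_partialSum_le zero_le_two (partialSum_realPart_le T)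

theorem MemIdeal.imaginaryPart {p : ℝ} {T : H →L[ℂ] H} (hT : MemIdeal p T) :
    MemIdeal p (ℑ T : H →L[ℂ] H) :=
  hT.of_partialSum_le zero_le_two (partialSum_imaginaryPart_le T)

/-- The Dixmier trace on self-adjoint operators. -/
def dixmierSA (ω : DixmierLimit) (A : H →L[ℂ] H) : ℝ :=
  dixmierPos ω A⁺ - dixmierPos ω A⁻

/-- Any decomposition into positive operators of the ideal may replace the canonical one: apply
`dixmierPos_add` to both sides of `(P - Q)⁺ + Q = P + (P - Q)⁻`. -/
theorem dixmierSA_sub (ω : DixmierLimit) {P Q : H →L[ℂ] H} (hP : 0 ≤ P) (hQ : 0 ≤ Q)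
    (hP' : MemIdeal 1 P) (hQ' : MemIdeal 1 Q) :
    dixmierSA ω (P - Q) = dixmierPos ω P - dixmierPos ω Q := by
  have hs : IsSelfAdjoint (P - Q) := (IsSelfAdjoint.of_nonneg hP).sub (IsSelfAdjoint.of_nonneg hQ)
  have hm : MemIdeal 1 (P - Q) := by
    have := hP'.add (hQ'.smul (-1))
    rwa [neg_one_smul, ← sub_eq_add_neg] at this
  have h1 := dixmierPos_add ω (CFC.posPart_nonneg (P - Q)) hQ (hm.posPart hs) hQ'
  have h2 := dixmierPos_add ω hP (CFC.negPart_nonneg (P - Q)) hP' (hm.negPart hs)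
  have h3 : (P - Q)⁺ + Q = P + (P - Q)⁻ := by
    have := CFC.posPart_sub_negPart (P - Q) hs
    rw [sub_eq_iff_eq_add] at this
    rw [this]
    abel
  rw [h3, h2] at h1
  rw [dixmierSA]
  linarith

theorem dixmierSA_add (ω : DixmierLimit) {A B : H →L[ℂ] H} (hA : IsSelfAdjoint A)
    (hB : IsSelfAdjoint B) (hA' : MemIdeal 1 A) (hB' : MemIdeal 1 B) :
    dixmierSA ω (A + B) = dixmierSA ω A + dixmierSA ω B := by
  have h : A + B = (A⁺ + B⁺) - (A⁻ + B⁻) := by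
    rw [add_sub_add_comm, CFC.posPart_sub_negPart A hA, CFC.posPart_sub_negPart B hB]
  rw [h, dixmierSA_sub ω (add_nonneg (CFC.posPart_nonneg A) (CFC.posPart_nonneg B))
    (add_nonneg (CFC.negPart_nonneg A) (CFC.negPart_nonneg B))
    ((hA'.posPart hA).add (hB'.posPart hB)) ((hA'.negPart hA).add (hB'.negPart hB)),
    dixmierPos_add ω (CFC.posPart_nonneg A) (CFC.posPart_nonneg B) (hA'.posPart hA)
      (hB'.posPart hB),
    dixmierPos_add ω (CFC.negPart_nonneg A) (CFC.negPart_nonneg B) (hA'.negPart hA)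
      (hB'.negPart hB), dixmierSA, dixmierSA]
  ring

theorem dixmierSA_smul (ω : DixmierLimit) (c : ℝ) {A : H →L[ℂ] H} (hA : IsSelfAdjoint A)
    (hA' : MemIdeal 1 A) : dixmierSA ω (c • A) = c * dixmierSA ω A := by
  have hP := CFC.posPart_nonneg A
  have hN := CFC.negPart_nonneg A
  have hdec := CFC.posPart_sub_negPart A hA
  rcases le_total 0 c with hc | hc
  · have h : c • A = c • A⁺ - c • A⁻ := by rw [← smul_sub, hdec]
    rw [h, dixmierSA_sub ω (smul_nonneg hc hP) (smul_nonneg hc hN)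
      ((hA'.posPart hA).real_smul c) ((hA'.negPart hA).real_smul c),
      dixmierPos_smul ω hc (hA'.posPart hA), dixmierPos_smul ω hc (hA'.negPart hA), dixmierSA]
    ring
  · have hc' : 0 ≤ -c := neg_nonneg.2 hc
    have h : c • A = (-c) • A⁻ - (-c) • A⁺ := by
      rw [← smul_sub, ← neg_sub, hdec, smul_neg, neg_smul, neg_neg]
    rw [h, dixmierSA_sub ω (smul_nonneg hc' hN) (smul_nonneg hc' hP)
      ((hA'.negPart hA).real_smul _) ((hA'.posPart hA).real_smul _),
      dixmierPos_smul ω hc' (hA'.posPart hA), dixmierPos_smul ω hc' (hA'.negPart hA), dixmierSA]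
    ring

theorem dixmierTrace_eq (ω : DixmierLimit) (T : H →L[ℂ] H) :
    dixmierTrace ω T = (dixmierSA ω (ℜ T : H →L[ℂ] H) : ℂ) +
      Complex.I * (dixmierSA ω (ℑ T : H →L[ℂ] H) : ℂ) :=
  rfl

theorem dixmierTrace_add (ω : DixmierLimit) {S T : H →L[ℂ] H} (hS : MemIdeal 1 S)
    (hT : MemIdeal 1 T) :
    dixmierTrace ω (S + T) = dixmierTrace ω S + dixmierTrace ω T := by
  rw [dixmierTrace_eq, dixmierTrace_eq, dixmierTrace_eq, map_add, map_add, AddSubgroup.coe_add,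
    AddSubgroup.coe_add,
    dixmierSA_add ω (ℜ S).2 (ℜ T).2 hS.realPart hT.realPart,
    dixmierSA_add ω (ℑ S).2 (ℑ T).2 hS.imaginaryPart hT.imaginaryPart]
  push_cast
  ring

theorem dixmierTrace_smul (ω : DixmierLimit) (c : ℂ) {T : H →L[ℂ] H} (hT : MemIdeal 1 T) :
    dixmierTrace ω (c • T) = c * dixmierTrace ω T := by
  have hR := hT.realPart
  have hI := hT.imaginaryPart
  have hRs : IsSelfAdjoint (ℜ T : H →L[ℂ] H) := (ℜ T).2
  have hIs : IsSelfAdjoint (ℑ T : H →L[ℂ] H) := (ℑ T).2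
  have h1 : ((ℜ (c • T) : selfAdjoint (H →L[ℂ] H)) : H →L[ℂ] H) =
      c.re • (ℜ T : H →L[ℂ] H) + (-c.im) • (ℑ T : H →L[ℂ] H) := by
    rw [realPart_smul, neg_smul, ← sub_eq_add_neg]
    rfl
  have h2 : ((ℑ (c • T) : selfAdjoint (H →L[ℂ] H)) : H →L[ℂ] H) =
      c.re • (ℑ T : H →L[ℂ] H) + c.im • (ℜ T : H →L[ℂ] H) := by
    rw [imaginaryPart_smul]
    rfl
  rw [dixmierTrace_eq, h1, h2,
    dixmierSA_add ω ((IsSelfAdjoint.all c.re).smul hRs) ((IsSelfAdjoint.all _).smul hIs)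
      (hR.real_smul _) (hI.real_smul _),
    dixmierSA_add ω ((IsSelfAdjoint.all c.re).smul hIs) ((IsSelfAdjoint.all _).smul hRs)
      (hI.real_smul _) (hR.real_smul _),
    dixmierSA_smul ω _ hRs hR, dixmierSA_smul ω _ hRs hR, dixmierSA_smul ω _ hIs hI,
    dixmierSA_smul ω _ hIs hI, dixmierTrace_eq]
  apply Complex.ext
  · simp [← sub_eq_add_neg]
  · simp

/-- Bounded partial sums, the trace class condition, pass to the four positive parts of `T`, and a
bounded sequence divided by `log N` tends to zero. -/
theorem dixmierTrace_eq_zero (ω : DixmierLimit) {T : H →L[ℂ] H} {C : ℝ}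
    (h : ∀ N, partialSum T N ≤ C) : dixmierTrace ω T = 0 := by
  have hsa : ∀ A : H →L[ℂ] H, IsSelfAdjoint A → (∀ N, partialSum A N ≤ 2 * partialSum T N) →
      dixmierSA ω A = 0 := by
    intro A hA hle
    have hle' : ∀ N, partialSum A N ≤ 2 * C := fun N => (hle N).trans (by linarith [h N])
    rw [dixmierSA, dixmierPos_eq_zero ω fun N => (partialSum_posPart_le hA N).trans (hle' N),
      dixmierPos_eq_zero ω fun N => (partialSum_negPart_le hA N).trans (hle' N), sub_zero]
  rw [dixmierTrace_eq, hsa _ (ℜ T).2 (partialSum_realPart_le T),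
    hsa _ (ℑ T).2 (partialSum_imaginaryPart_le T)]
  simp

theorem charValue_unitary_conj {U : H →L[ℂ] H} (hU : U ∈ unitary (H →L[ℂ] H)) (T : H →L[ℂ] H)
    (k : ℕ) : charValue (U * T * star U) k = charValue T k := by
  have key : ∀ V ∈ unitary (H →L[ℂ] H), ∀ S : H →L[ℂ] H,
      charValue (V * S * star V) k ≤ charValue S k := by
    intro V hV S
    have hn : ‖V‖ ≤ 1 := by
      have h1 := CStarRing.norm_star_mul_self (x := V)
      have h2 : ‖(1 : H →L[ℂ] H)‖ ≤ 1 := ContinuousLinearMap.norm_id_le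
      rw [Unitary.star_mul_self_of_mem hV] at h1
      nlinarith [norm_nonneg V]
    refine (charValue_mul_right_le _ _ k).trans ?_
    refine (mul_le_of_le_one_right (charValue_nonneg _ _) ((norm_star V).trans_le hn)).trans ?_
    exact (charValue_mul_left_le _ _ k).trans (mul_le_of_le_one_left (charValue_nonneg _ _) hn)
  refine le_antisymm (key U hU T) ?_
  have h := key (star U) (Unitary.star_mem hU) (U * T * star U)
  have e : star U * (U * T * star U) * star (star U) = T := by
    rw [star_star]
    calc star U * (U * T * star U) * U = (star U * U) * T * (star U * U) := by noncomm_ring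
      _ = T := by rw [Unitary.star_mul_self_of_mem hU, one_mul, mul_one]
  rwa [e] at h

theorem dixmierSA_unitary_conj (ω : DixmierLimit) {U : H →L[ℂ] H}
    (hU : U ∈ unitary (H →L[ℂ] H)) {A : H →L[ℂ] H} (hA : IsSelfAdjoint A)
    (hA' : MemIdeal 1 A) : dixmierSA ω (U * A * star U) = dixmierSA ω A := by
  have h : U * A * star U = U * A⁺ * star U - U * A⁻ * star U := by
    rw [← sub_mul, ← mul_sub, CFC.posPart_sub_negPart A hA]
  have hp := hA'.posPart hA
  have hn := hA'.negPart hA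
  rw [h, dixmierSA_sub ω (star_right_conjugate_nonneg (CFC.posPart_nonneg A) U)
    (star_right_conjugate_nonneg (CFC.negPart_nonneg A) U)
    ((hp.mul_left U).mul_right _) ((hn.mul_left U).mul_right _),
    dixmierPos_congr ω hp (charValue_unitary_conj hU _),
    dixmierPos_congr ω hn (charValue_unitary_conj hU _), dixmierSA]

theorem dixmierTrace_unitary_conj (ω : DixmierLimit) {U : H →L[ℂ] H}
    (hU : U ∈ unitary (H →L[ℂ] H)) {T : H →L[ℂ] H} (hT : MemIdeal 1 T) :
    dixmierTrace ω (U * T * star U) = dixmierTrace ω T := by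
  have h1 : ((ℜ (U * T * star U) : selfAdjoint (H →L[ℂ] H)) : H →L[ℂ] H) =
      U * (ℜ T : H →L[ℂ] H) * star U := by
    rw [realPart_apply_coe, realPart_apply_coe, star_mul, star_mul, star_star, mul_smul_comm,
      smul_mul_assoc, mul_add, add_mul, mul_assoc U (star T)]
  have h2 : ((ℑ (U * T * star U) : selfAdjoint (H →L[ℂ] H)) : H →L[ℂ] H) =
      U * (ℑ T : H →L[ℂ] H) * star U := by
    rw [imaginaryPart_apply_coe, imaginaryPart_apply_coe, star_mul, star_mul, star_star,
      mul_smul_comm, smul_mul_assoc, mul_smul_comm, smul_mul_assoc, mul_sub, sub_mul,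
      mul_assoc U (star T)]
  rw [dixmierTrace_eq, h1, h2, dixmierSA_unitary_conj ω hU (ℜ T).2 hT.realPart,
    dixmierSA_unitary_conj ω hU (ℑ T).2 hT.imaginaryPart, dixmierTrace_eq]

/-- For unitary `U`, `U T = U (T U) U*` is a unitary conjugate of `T U`. Both sides are linear in
`X`, and unitaries span. -/
theorem dixmierTrace_mul_comm (ω : DixmierLimit) {T : H →L[ℂ] H} (hT : MemIdeal 1 T)
    (X : H →L[ℂ] H) : dixmierTrace ω (X * T) = dixmierTrace ω (T * X) := by
  have hX : X ∈ Submodule.span ℂ (unitary (H →L[ℂ] H) : Set (H →L[ℂ] H)) := by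
    rw [CStarAlgebra.span_unitary]
    trivial
  induction hX using Submodule.span_induction with
  | mem U hU =>
    rw [← dixmierTrace_unitary_conj ω hU (hT.mul_right U), ← mul_assoc U T U, mul_assoc (U * T),
      Unitary.mul_star_self_of_mem hU, mul_one]
  | zero => rw [zero_mul, mul_zero]
  | add Y Z _ _ hY hZ =>
    rw [add_mul, mul_add, dixmierTrace_add ω (hT.mul_left Y) (hT.mul_left Z),
      dixmierTrace_add ω (hT.mul_right Y) (hT.mul_right Z), hY, hZ]
  | smul c Y _ hY =>
    rw [smul_mul_assoc, mul_smul_comm, dixmierTrace_smul ω c (hT.mul_left Y),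
      dixmierTrace_smul ω c (hT.mul_right Y), hY]

end Trace

/-! ### Decay of characteristic values and the telescoped commutator -/

section Decay

/-- A discrete form of comparison with `∫ x^(-s)`; the inductive step is Bernoulli's inequality for
the exponent `1 - s` at `-1 / (N + 1)`. -/
theorem sum_rpow_le {s : ℝ} (hs0 : 0 < s) (hs1 : s < 1) (N : ℕ) :
    (1 - s) * ∑ k ∈ Finset.range N, ((k : ℝ) + 1) ^ (-s) ≤ (N : ℝ) ^ (1 - s) := by
  induction N with
  | zero => simp [(sub_pos.2 hs1).ne']
  | succ N ih =>
    rw [Finset.sum_range_succ, mul_add]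
    push_cast
    have hpos : (0 : ℝ) < (N : ℝ) + 1 := by positivity
    have h1 : (1 + -(1 / ((N : ℝ) + 1))) ^ (1 - s) ≤ 1 + (1 - s) * -(1 / ((N : ℝ) + 1)) := by
      refine rpow_one_add_le_one_add_mul_self ?_ (by linarith) (by linarith)
      rw [neg_le_neg_iff, div_le_one hpos]
      linarith [(Nat.cast_nonneg N : (0 : ℝ) ≤ N)]
    have h2 : (1 + -(1 / ((N : ℝ) + 1))) = N / (N + 1) := by
      field_simp
      ring
    rw [h2, Real.div_rpow (Nat.cast_nonneg N) hpos.le, div_le_iff₀ (by positivity)] at h1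
    have h3 : ((N : ℝ) + 1) ^ (-s) = (1 / (N + 1)) * ((N : ℝ) + 1) ^ (1 - s) := by
      rw [sub_eq_add_neg, Real.rpow_add hpos, Real.rpow_one]
      field_simp
    rw [h3]
    linarith

variable {H : Type*} [NormedAddCommGroup H] [InnerProductSpace ℂ H]

/-- By monotonicity `(k + 1) μ_k ≤ σ_{k+1}`, and the right side is `O((k + 1)^(1 - s))`. At `s = 1`
this argument would lose a logarithm. -/
theorem charValue_le_rpow {T : H →L[ℂ] H} {s : ℝ} (hs0 : 0 < s) (hs1 : s < 1) {C : ℝ}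
    (hC0 : 0 ≤ C)
    (hC : ∀ N, partialSum T N ≤ C * ∑ k ∈ Finset.range N, ((k : ℝ) + 1) ^ (-s)) (k : ℕ) :
    charValue T k ≤ C / (1 - s) * ((k : ℝ) + 1) ^ (-s) := by
  have hpos : (0 : ℝ) < (k : ℝ) + 1 := by positivity
  have h1s : 0 < 1 - s := sub_pos.2 hs1
  have h1 : ((k : ℝ) + 1) * charValue T k ≤ partialSum T (k + 1) := by
    calc ((k : ℝ) + 1) * charValue T k = ∑ _j ∈ Finset.range (k + 1), charValue T k := by simp
      _ ≤ _ := Finset.sum_le_sum fun j hj =>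
        charValue_antitone T (Nat.lt_succ_iff.1 (Finset.mem_range.1 hj))
  have h2 := hC (k + 1)
  have h3 := sum_rpow_le hs0 hs1 (k + 1)
  push_cast at h3
  rw [← le_div_iff₀' h1s] at h3
  have h4 := (h1.trans h2).trans (mul_le_mul_of_nonneg_left h3 hC0)
  have h5 : ((k : ℝ) + 1) ^ (1 - s) = (k + 1) * ((k : ℝ) + 1) ^ (-s) := by
    rw [sub_eq_add_neg, Real.rpow_add hpos, Real.rpow_one]
  rw [h5] at h4
  refine le_of_mul_le_mul_left (h4.trans_eq ?_) hpos
  ring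

theorem MemIdeal.exists_nonneg {p : ℝ} {T : H →L[ℂ] H} (hT : MemIdeal p T) :
    ∃ C : ℝ, 0 ≤ C ∧ ∀ N : ℕ,
      partialSum T N ≤ C * ∑ k ∈ Finset.range N, ((k : ℝ) + 1) ^ (-(1 / p)) := by
  obtain ⟨C, hC⟩ := hT
  have h := (partialSum_nonneg T 1).trans (hC 1)
  exact ⟨C, by simpa using h, hC⟩

/-- For `n > 1`, `μ_{nk}(Rⁿ) ≤ μ_k(R)ⁿ = O(1 / (k + 1))`. For `n = 1` no such pointwise bound is at
hand, but there is nothing to prove. -/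
theorem MemIdeal.pow {n : ℕ} (hn : 1 ≤ n) {R : H →L[ℂ] H} (hR : MemIdeal n R) :
    MemIdeal 1 (R ^ n) := by
  rcases hn.eq_or_lt with rfl | hn
  · simpa using hR
  obtain ⟨C, hC0, hC⟩ := hR.exists_nonneg
  have hn' : (1 : ℝ) < n := by exact_mod_cast hn
  have hn0 : (0 : ℝ) < n := by linarith
  have hk := charValue_le_rpow (by positivity) ((div_lt_one hn0).2 hn') hC0 hC
  set K := C / (1 - 1 / (n : ℝ))
  refine ⟨n * K ^ n, fun N => ?_⟩
  refine (partialSum_mono _ (Nat.le_mul_of_pos_left N (by omega : 0 < n))).trans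
    ((partialSum_mul_le _ n N).trans ?_)
  rw [mul_assoc]
  refine mul_le_mul_of_nonneg_left ?_ hn0.le
  rw [Finset.mul_sum]
  refine Finset.sum_le_sum fun k _ => ?_
  refine (charValue_pow_le R k n).trans ?_
  refine (pow_le_pow_left₀ (charValue_nonneg R k) (hk k) n).trans_eq ?_
  rw [mul_pow, ← Real.rpow_mul_natCast (by positivity)]
  congr 2
  field_simp

theorem MemIdeal.summable_charValue_pow {n : ℕ} (hn : 1 ≤ n) {R : H →L[ℂ] H}
    (hR : MemIdeal n R) : Summable fun k => charValue R k ^ (n + 1) := by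
  have hex : ∃ (s K : ℝ), 1 < s * ((n + 1 : ℕ) : ℝ) ∧
      ∀ k : ℕ, charValue R k ≤ K * ((k : ℝ) + 1) ^ (-s) := by
    obtain ⟨C, hC0, hC⟩ := hR.exists_nonneg
    rcases hn.eq_or_lt with rfl | hn
    -- When `n = 1` the exponent must be below `1` for `charValue_le_rpow` and above `1 / 2` for the
    -- squares to be summable; `3 / 4` is one such choice.
    · refine ⟨3 / 4, _, by norm_num, charValue_le_rpow (s := 3 / 4) (by norm_num) (by norm_num)
        hC0 fun N => (hC N).trans ?_⟩
      refine mul_le_mul_of_nonneg_left (Finset.sum_le_sum fun k _ => ?_) hC0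
      exact Real.rpow_le_rpow_of_exponent_le
        (by linarith [(Nat.cast_nonneg k : (0 : ℝ) ≤ k)]) (by norm_num)
    · have hn' : (1 : ℝ) < n := by exact_mod_cast hn
      have hn0 : (0 : ℝ) < n := by linarith
      refine ⟨1 / n, _, ?_, charValue_le_rpow (by positivity) ((div_lt_one hn0).2 hn') hC0 hC⟩
      rw [one_div_mul_eq_div, lt_div_iff₀ hn0]
      push_cast
      linarith
  obtain ⟨s, K, hs, hK⟩ := hex
  have hsum : Summable fun k : ℕ => K ^ (n + 1) * ((k : ℝ) + 1) ^ (-(s * ((n + 1 : ℕ) : ℝ))) := by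
    have h := (summable_nat_add_iff 1).2 (Real.summable_nat_rpow.2 (neg_lt_neg hs))
    refine Summable.mul_left _ ?_
    exact_mod_cast h
  refine Summable.of_nonneg_of_le (fun k => pow_nonneg (charValue_nonneg R k) _) (fun k => ?_) hsum
  refine (pow_le_pow_left₀ (charValue_nonneg R k) (hK k) _).trans_eq ?_
  rw [mul_pow, ← Real.rpow_mul_natCast (by positivity), neg_mul]

/-- `R ^ i B R ^ j` has bounded partial sums when `i + j = n + 1` and `R ∈ 𝓛^{n,∞}`. -/
theorem MemIdeal.partialSum_pow_mul_pow_bounded {n : ℕ} (hn : 1 ≤ n) {R : H →L[ℂ] H}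
    (hR : MemIdeal n R) (B : H →L[ℂ] H) {i j : ℕ} (hij : i + j = n + 1) :
    ∃ C : ℝ, ∀ N, partialSum (R ^ i * B * R ^ j) N ≤ C := by
  refine ⟨(n + 1 : ℕ) * (‖B‖ * ∑' k, charValue R k ^ (n + 1)), fun N => ?_⟩
  refine (partialSum_mono _ (Nat.le_mul_of_pos_left N n.succ_pos)).trans
    ((partialSum_mul_le _ (n + 1) N).trans ?_)
  refine mul_le_mul_of_nonneg_left ?_ (Nat.cast_nonneg _)
  refine le_trans ?_ (mul_le_mul_of_nonneg_left
    ((hR.summable_charValue_pow hn).sum_le_tsum (Finset.range N)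
      fun k _ => pow_nonneg (charValue_nonneg R k) _) (norm_nonneg B))
  rw [Finset.mul_sum]
  refine Finset.sum_le_sum fun k _ => ?_
  -- Splitting the index as `i * k + j * k` gives each power of `R` its own share in
  -- submultiplicativity.
  rw [← hij, add_mul]
  have h0 := charValue_nonneg R k
  calc charValue (R ^ i * B * R ^ j) (i * k + j * k)
      ≤ charValue (R ^ i * B) (i * k) * charValue (R ^ j) (j * k) := charValue_mul_le _ _ _ _
    _ ≤ (charValue R k ^ i * ‖B‖) * charValue R k ^ j := by
      refine mul_le_mul ?_ (charValue_pow_le R k j) (charValue_nonneg _ _) (by positivity)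
      exact (charValue_mul_right_le _ _ _).trans
        (mul_le_mul_of_nonneg_right (charValue_pow_le R k i) (norm_nonneg B))
    _ = ‖B‖ * charValue R k ^ (i + j) := by rw [pow_add]; ring

/-- Each `R` moved to the left turns `a j` into `a (j + 1)` and leaves `R * B j * R`. One factor of
`R` is gained, so each term has `m + 1` of them. -/
theorem mul_pow_sub_pow_mul_eq_sum {M : Type*} [Ring M] {R : M} {a B : ℕ → M}
    (h : ∀ j, a j * R - R * a (j + 1) = R * B j * R) (m : ℕ) :
    a 0 * R ^ m - R ^ m * a m = ∑ j ∈ Finset.range m, R ^ (j + 1) * B j * R ^ (m - j) := by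
  induction m with
  | zero => simp
  | succ m ih =>
    have h1 : a 0 * R ^ (m + 1) - R ^ (m + 1) * a (m + 1) =
        (a 0 * R ^ m - R ^ m * a m) * R + R ^ m * (a m * R - R * a (m + 1)) := by
      rw [pow_succ]
      noncomm_ring
    rw [h1, ih, h, Finset.sum_range_succ, Finset.sum_mul]
    congr 1
    · refine Finset.sum_congr rfl fun j hj => ?_
      rw [Nat.succ_sub (Finset.mem_range.1 hj).le, pow_succ R (m - j)]
      simp only [mul_assoc]
    · rw [Nat.add_sub_cancel_left, pow_one, pow_succ]
      simp only [mul_assoc]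

/-- Evaluate the twisted commutator at `R y`, which lies in the domain, and apply `R`. -/
theorem IsInverse.exists_commutator {D : H →ₗ.[ℂ] H} {R : H →L[ℂ] H} (hR : IsInverse D R)
    {b c : H →L[ℂ] H} (h : BoundedTwistedCommutator D b c) :
    ∃ B : H →L[ℂ] H, b * R - R * c = R * B * R := by
  obtain ⟨B, hB⟩ := h
  refine ⟨B, ?_⟩
  ext y
  have h1 := (hR _ _).1 (hB (R y) y ((hR _ _).2 rfl))
  rw [map_add] at h1
  change b (R y) - R (c y) = R (B (R y))
  rw [← h1, add_sub_cancel_left]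

theorem sum_partialSum_bounded {ι : Type*} (s : Finset ι) {f : ι → H →L[ℂ] H}
    (h : ∀ i ∈ s, ∃ C : ℝ, ∀ N, partialSum (f i) N ≤ C) :
    ∃ C : ℝ, ∀ N, partialSum (∑ i ∈ s, f i) N ≤ C := by
  refine Finset.sum_induction f (fun T => ∃ C : ℝ, ∀ N, partialSum T N ≤ C) ?_ ?_ h
  · rintro S T ⟨C, hC⟩ ⟨C', hC'⟩
    exact ⟨2 * (C + C'), fun N => (partialSum_add_le_two_mul S T N).trans
      (by linarith [hC N, hC' N])⟩
  · exact ⟨0, fun N => Finset.sum_nonpos fun k _ =>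
      (charValue_le_norm _ k).trans_eq norm_zero⟩

end Decay

/-! ### The twisted trace property -/

section Main

variable {A H : Type*} [NonUnitalRing A] [Module ℂ A] [NormedAddCommGroup H]
  [InnerProductSpace ℂ H] [CompleteSpace H]

/-- The twisted trace property of `T ↦ Tr_ω(T R ^ n)`. -/
theorem dixmierTrace_twisted (π : A →ₙₐ[ℂ] (H →L[ℂ] H)) (σ : A ≃ₗ[ℂ] A) {D : H →ₗ.[ℂ] H}
    (hb : ∀ a : A, BoundedTwistedCommutator D (π a) (π (σ a))) {n : ℕ} (hn : 1 ≤ n)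
    {R : H →L[ℂ] H} (hR : IsInverse D R) (hsum : MemIdeal n R) (ω : DixmierLimit)
    (T : H →L[ℂ] H) (a : A) :
    dixmierTrace ω (T * π ((σ ^ (-(n : ℤ))) a) * R ^ n) = dixmierTrace ω (π a * T * R ^ n) := by
  have hpow := hsum.pow hn
  -- Telescoping runs along `b, σ(b), …, σⁿ(b) = a`, which is where the twist `σ⁻ⁿ` comes from.
  set b := (σ ^ (-(n : ℤ))) a with hbdef
  have hσ : (σ ^ n) b = a := by
    rw [hbdef, zpow_neg, zpow_natCast, ← LinearEquiv.mul_apply, mul_inv_cancel]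
    rfl
  have hcomm : ∀ j : ℕ, ∃ B : H →L[ℂ] H,
      π ((σ ^ j) b) * R - R * π ((σ ^ (j + 1)) b) = R * B * R := by
    intro j
    rw [pow_succ' σ j]
    exact hR.exists_commutator (hb _)
  choose B hB using hcomm
  have hE := mul_pow_sub_pow_mul_eq_sum (a := fun j => π ((σ ^ j) b)) hB n
  simp only [pow_zero] at hE
  change π b * R ^ n - R ^ n * π ((σ ^ n) b) = _ at hE
  rw [hσ] at hE
  obtain ⟨C, hC⟩ := sum_partialSum_bounded (Finset.range n)
    (f := fun j => R ^ (j + 1) * B j * R ^ (n - j)) fun j hj =>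
      hsum.partialSum_pow_mul_pow_bounded hn (B j)
        (by have := Finset.mem_range.1 hj; omega)
  rw [← hE] at hC
  set E := π b * R ^ n - R ^ n * π a with hEdef
  have hEm : MemIdeal 1 E := by
    have h := (hpow.mul_left (π b)).add ((hpow.mul_right (π a)).smul (-1))
    rwa [neg_one_smul, ← sub_eq_add_neg] at h
  -- `E` is trace class, so `T * E` contributes nothing; the other term is rotated cyclically.
  have h1 : T * π b * R ^ n = T * R ^ n * π a + T * E := by
    rw [hEdef]
    noncomm_ring
  have h2 : dixmierTrace ω (T * E) = 0 :=
    dixmierTrace_eq_zero ω (C := ‖T‖ * C) fun N => (partialSum_mul_left_le T E N).trans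
      (mul_le_mul_of_nonneg_left (hC N) (norm_nonneg T))
  rw [h1, dixmierTrace_add ω ((hpow.mul_left T).mul_right _) (hEm.mul_left T), h2, add_zero,
    ← dixmierTrace_mul_comm ω (hpow.mul_left T), mul_assoc]

/-- Phrased through bounded commutators and a bounded inverse alone, so that it serves both `D` and
`opAbs D`. -/
theorem twistedTrace_statements (π : A →ₙₐ[ℂ] (H →L[ℂ] H)) (σ : A ≃ₗ[ℂ] A) {D : H →ₗ.[ℂ] H}
    (hb : ∀ a : A, BoundedTwistedCommutator D (π a) (π (σ a))) {n : ℕ} (hn : 1 ≤ n)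
    {R : H →L[ℂ] H} (hR : IsInverse D R) (hsum : MemIdeal n R) (ω : DixmierLimit) :
    (∀ T : H →L[ℂ] H, MemIdeal 1 (T * R ^ n)) ∧
      (∃ φ : A →ₗ[ℂ] ℂ, (∀ a : A, φ a = dixmierTrace ω (π a * R ^ n)) ∧
        IsTwistedTrace (σ ^ (-(n : ℤ))) φ) ∧
      (∀ (T : H →L[ℂ] H) (a : A),
        dixmierTrace ω (T * π ((σ ^ (-(n : ℤ))) a) * R ^ n) =
          dixmierTrace ω (π a * T * R ^ n)) := by
  have hmem := (hsum.pow hn).mul_left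
  have htw := dixmierTrace_twisted π σ hb hn hR hsum ω
  let φ : A →ₗ[ℂ] ℂ :=
    { toFun := fun a => dixmierTrace ω (π a * R ^ n)
      map_add' := fun a b => by
        rw [map_add, add_mul, dixmierTrace_add ω (hmem _) (hmem _)]
      map_smul' := fun c a => by
        rw [map_smul, smul_mul_assoc, dixmierTrace_smul ω c (hmem _)]
        rfl }
  refine ⟨hmem, ⟨φ, fun a => rfl, fun a b => ?_⟩, htw⟩
  change dixmierTrace ω (π (a * b) * R ^ n) = dixmierTrace ω (π (b * _) * R ^ n)
  rw [map_mul, map_mul]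
  -- The twisted trace identity is the case `T = π b`, read from right to left.
  exact (htw (π b) a).symm

/-- `|R|² = R* R` gives `‖|R| x‖ = ‖R x‖` for every `x`. Thus the inverse of `|D|` inherits the
summability of the inverse of `D`. -/
theorem charValue_abs (R : H →L[ℂ] H) (k : ℕ) : charValue (CFC.abs R) k ≤ charValue R k := by
  refine charValue_le_of_norm_apply_le (fun x => le_of_eq ?_) k
  have hs : star (CFC.abs R) = CFC.abs R := (IsSelfAdjoint.of_nonneg (CFC.abs_nonneg R)).star_eq
  have h : star (CFC.abs R) * CFC.abs R = star R * R := by rw [hs, CFC.abs_mul_abs]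
  have key : ∀ S : H →L[ℂ] H, inner ℂ x ((star S * S) x) = ((‖S x‖ ^ 2 : ℝ) : ℂ) := by
    intro S
    rw [ContinuousLinearMap.star_eq_adjoint]
    change inner ℂ x (ContinuousLinearMap.adjoint S (S x)) = _
    rw [ContinuousLinearMap.adjoint_inner_right, inner_self_eq_norm_sq_to_K]
    push_cast
    rfl
  have h1 := key (CFC.abs R)
  rw [h, key R] at h1
  have h2 := Complex.ofReal_injective h1
  exact ((pow_left_inj₀ (norm_nonneg _) (norm_nonneg _) two_ne_zero).1 h2).symm

end Main

end TwistedTriple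

end

open TwistedTriple in
theorem mainTheorem6 {A H : Type*} [NonUnitalRing A] [Module ℂ A] [IsScalarTower ℂ A A]
    [SMulCommClass ℂ A A] [NormedAddCommGroup H] [InnerProductSpace ℂ H] [CompleteSpace H]
    (π : A →ₙₐ[ℂ] (H →L[ℂ] H)) (σ : A ≃ₗ[ℂ] A) (D : H →ₗ.[ℂ] H)
    (hD : IsSpectralTriple π σ D)
    (n : ℕ) (hn : 1 ≤ n)
    (Dinv : H →L[ℂ] H) (hDinv : IsInverse D Dinv) (hsum : MemIdeal n Dinv)
    (ω : DixmierLimit) :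
    ((∀ T : H →L[ℂ] H, MemIdeal 1 (T * Dinv ^ n)) ∧
      (∃ φ : A →ₗ[ℂ] ℂ, (∀ a : A, φ a = dixmierTrace ω (π a * Dinv ^ n)) ∧
        IsTwistedTrace (σ ^ (-(n : ℤ))) φ) ∧
      (∀ (T : H →L[ℂ] H) (a : A),
        dixmierTrace ω (T * π ((σ ^ (-(n : ℤ))) a) * Dinv ^ n) =
          dixmierTrace ω (π a * T * Dinv ^ n))) ∧
    (IsLipschitzRegular π σ D →
      ∃ absDinv : H →L[ℂ] H, IsInverse (opAbs D) absDinv ∧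
        (∀ T : H →L[ℂ] H, MemIdeal 1 (T * absDinv ^ n)) ∧
        (∃ φ : A →ₗ[ℂ] ℂ, (∀ a : A, φ a = dixmierTrace ω (π a * absDinv ^ n)) ∧
          IsTwistedTrace (σ ^ (-(n : ℤ))) φ) ∧
        (∀ (T : H →L[ℂ] H) (a : A),
          dixmierTrace ω (T * π ((σ ^ (-(n : ℤ))) a) * absDinv ^ n) =
            dixmierTrace ω (π a * T * absDinv ^ n))) := by
  refine ⟨twistedTrace_statements π σ hD.bounded hn hDinv hsum ω, fun hL => ?_⟩
  -- The inverse of the unbounded `|D|` is the bounded absolute value of `Dinv`.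
  have habs : IsInverse (opAbs D) (CFC.abs Dinv) :=
    ((isAbs_iff hD.selfAdjoint hDinv).1 (opAbs_spec hD.selfAdjoint hDinv)).2
  refine ⟨CFC.abs Dinv, habs, twistedTrace_statements π σ hL hn habs ?_ ω⟩
  refine hsum.of_partialSum_le zero_le_one fun N => ?_
  rw [one_mul]
  exact Finset.sum_le_sum fun k _ => charValue_abs Dinv k
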